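/- **Setting.** Let $(\mathbb X,d)$ be a complete separable metric space with its Borel $\sigma$-algebra, $\mathbb U$ a finite action set (with the discrete topology), $\mathcal T(dx'\mid x,u)$ a controlled transition kernel on $\mathbb X$, $c:\mathbb X\times\mathbb U\to\mathbb R$ a cost and $\beta\in(0,1)$ a discount factor. For an admissible (history-dependent, randomized) policy $\gamma$ let $J_\beta(c,\mathcal T,\gamma)(x)=\mathbb E^{\mathcal T,\gamma}\big[\sum_{t\ge 0}\beta^t c(X_t,U_t)\mid X_0=x\big]$ and $J_\beta^*(c,\mathcal T)(x)=\inf_\gamma J_\beta(c,\mathcal T,\gamma)(x)$, the infimum over all admissible policies. Assume that the MDP is *Wasserstein regular* with constants $\|c\|_\infty,\|c\|_{\rm Lip},\|\mathcal T\|_{\rm Lip}\ge 0$: $c$ is continuous with $0\le c\le\|c\|_\infty$; $(x,u)\mapsto\int v\,d\mathcal T(\cdot\mid x,u)$ is continuous for every bounded continuous $v$; for every $u$ and all $x,y$, $|c(x,u)-c(y,u)|\le\|c\|_{\rm Lip}\,d(x,y)$ and $\mathcal W_1(\mathcal T(\cdot\mid x,u),\mathcal T(\cdot\mid y,u))\le\|\mathcal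 T\|_{\rm Lip}\,d(x,y)$, where $\mathcal W_1(\mu,\nu)$ is the infimum of $\int d\,d\rho$ over all couplings $\rho$ of $\mu$ and $\nu$; and $\beta\|\mathcal T\|_{\rm Lip}<1$. **Exploration.** Let $\gamma$ be a probability mass function on $\mathbb U$ with $\gamma_u>0$ for all $u$. One observes a trajectory $(X_n,U_n)_{n\ge0}$: $X_0$ has an arbitrary law, every $U_n$ is drawn from $\gamma$ independently of $X_0,U_0,\dots,U_{n-1},X_n$, and $X_{n+1}\sim\mathcal T(\cdot\mid X_n,U_n)$ given the past. Let $B_1,\dots,B_M$ be a measurable partition of $\mathbb X$. Assume: (a) the chain $Z_n=(X_n,U_n,X_{n+1})$ is $\psi$-irreducible with a unique invariant probability measure $\tilde\pi$, of the form $\tilde\pi(A\times\{u\}\times A')=\gamma_u\int_A\mathcal T(A'\mid x,u)\,\pi(dx)$ with $\pi$ a probability measure on $\mathbb X$, and $\pi(B_i)>0$ for all $i$; (b) there are constants $C_0,c_0>0$ such that for all measurable $f:\mathbb X\times\mathbb U\times\mathbb X\to[0,1]$, all $\epsilon>0$ and all $n\ge1$, $$\mathbb P\Big(\Big|\tfrac1n\sum_{t=0}^{n-1}f(X_t,U_t,X_{t+1})-\int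 f\,d\tilde\pi\Big|\ge\epsilon\Big)\le C_0\exp(-c_0n\epsilon^2).$$ **Learned model.** For $N\ge1$ let $n_N(i,u)=\#\{n<N: X_n\in B_i,\,U_n=u\}$. The learned MDP has state space $[M]=\{1,\dots,M\}$ (state $i$ stands for the bin $B_i$), action set $\mathbb U$, and, if $n_N(i,u)>0$, $$\hat{\mathcal T}_N(j\mid i,u)=\frac{\#\{n<N: X_n\in B_i,\,U_n=u,\,X_{n+1}\in B_j\}}{n_N(i,u)},\qquad \hat c_N(i,u)=\frac{\sum_{n<N:\,X_n\in B_i,\,U_n=u}c(X_n,U_n)}{n_N(i,u)},$$ while $\hat{\mathcal T}_N(j\mid i,u)=\mathbf 1\{j=i\}$ and $\hat c_N(i,u)=0$ if $n_N(i,u)=0$. Let $\hat\gamma_{N,\beta}:[M]\to\mathbb U$ be any (measurably chosen) deterministic stationary policy that is optimal, from every initial state, for the $\beta$-discounted learned MDP $(\hat{\mathcal T}_N,\hat c_N)$, and let $\overline{\hat\gamma_{N,\beta}}(x)=\hat\gamma_{N,\beta}(i)$ for $x\in B_i$ be its extension to $\mathbb X$. Put $$\delta_M=\max_{1\le i\le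 M}\,\sup_{x,x'\in B_i}d(x,x')\in[0,\infty],\qquad \kappa_{\pi,M}=\min_{i\in[M],\,u\in\mathbb U}\gamma_u\,\pi(B_i).$$ **Theorem.** There is a constant $C>0$, depending only on $C_0,c_0,\|c\|_{\rm Lip},\|\mathcal T\|_{\rm Lip},\beta,\|c\|_\infty$ (in particular not on the partition, on $M$, $N$, $\mathbb U$, or $\pi$), such that $$\mathbb E\Big[\big\|J_\beta(c,\mathcal T,\overline{\hat\gamma_{N,\beta}})-J_\beta^*(c,\mathcal T)\big\|_\infty\Big]\le C\Big(\delta_M+\frac1{\kappa_{\pi,M}}\sqrt{\frac{\log(M|\mathbb U|)}N}\Big)+C\,M|\mathbb U|\exp\big(-C^{-1}\kappa_{\pi,M}^2N\big).$$ -/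

import Mathlib

open MeasureTheory ProbabilityTheory
open scoped ENNReal NNReal BoundedContinuousFunction

universe u v w

noncomputable section

namespace QuantizedMDP

section Control

variable {X : Type*} {U : Type*} [MeasurableSpace X] [MeasurableSpace U]

/-- An admissible (history dependent, randomized) policy. The history available at time `0` is the
initial state; the history available at time `n + 1` consists of the state-action pairs at the
times `0, …, n` together with the state at time `n + 1`. At each time the policy is a measurable
map from histories to probability measures on the action space, that is, a Markov kernel. -/
structure Policy (X : Type*) (U : Type*) [MeasurableSpace X] [MeasurableSpace U] where
  first : Kernel X U
  next : ∀ n : ℕ, Kernel ((Finset.Iic n → X × U) × X) U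
  first_markov : IsMarkovKernel first
  next_markov : ∀ n, IsMarkovKernel (next n)

namespace Policy

attribute [instance] first_markov next_markov

/-- The deterministic stationary policy `U_n = g (X_n)`. -/
def stationary (g : X → U) (hg : Measurable g) : Policy X U where
  first := Kernel.deterministic g hg
  next _ := Kernel.deterministic (fun p => g p.2) (hg.comp measurable_snd)
  first_markov := inferInstance
  next_markov _ := inferInstance

/-- The state-independent policy which draws every action from `γ`, independently of the past. -/
def exploration (γ : Measure U) [IsProbabilityMeasure γ] : Policy X U where
  first := Kernel.const _ γ
  next _ := Kernel.const _ γ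
  first_markov := inferInstance
  next_markov _ := inferInstance

/-- One step of the controlled process: given the state-action pairs up to time `n`, the next state
is drawn from `T` at the current pair and then the next action from the policy. -/
def stepKernel (T : Kernel (X × U) X) (γ : Policy X U) (n : ℕ) :
    Kernel (Finset.Iic n → X × U) (X × U) :=
  (T.comap (fun h : Finset.Iic n → X × U => h ⟨n, Finset.mem_Iic.2 le_rfl⟩)
    (measurable_pi_apply _)) ⊗ₖ (γ.next n)

instance (T : Kernel (X × U) X) [IsMarkovKernel T] (γ : Policy X U) (n : ℕ) :
    IsMarkovKernel (stepKernel T γ n) := by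
  unfold stepKernel
  infer_instance

end Policy

/-- The law of `(X_n, U_n)_{n ≥ 0}` when `X_0 ∼ ν`, the transitions follow `T` and the actions
follow the policy `γ`. -/
def pathLaw (T : Kernel (X × U) X) [IsMarkovKernel T] (γ : Policy X U) (ν : Measure X) :
    Measure (ℕ → X × U) :=
  Kernel.trajMeasure (X := fun _ => X × U) (ν ⊗ₘ γ.first) (Policy.stepKernel T γ)

/-- The expected discounted cost `J_β(c, T, γ)(x)`. -/
def discountedCost (β : ℝ) (c : X → U → ℝ) (T : Kernel (X × U) X) [IsMarkovKernel T]
    (γ : Policy X U) (x : X) : ℝ :=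
  ∫ z, ∑' t : ℕ, β ^ t * c (z t).1 (z t).2 ∂(pathLaw T γ (Measure.dirac x))

/-- The optimal discounted cost `J_β^*(c, T)(x)`, the infimum over all admissible policies. -/
def optimalCost (β : ℝ) (c : X → U → ℝ) (T : Kernel (X × U) X) [IsMarkovKernel T] (x : X) : ℝ :=
  ⨅ γ : Policy X U, discountedCost β c T γ x

/-- `‖J_β(c, T, γ) - J_β^*(c, T)‖_∞`. -/
def robustnessError (β : ℝ) (c : X → U → ℝ) (T : Kernel (X × U) X) [IsMarkovKernel T]
    (γ : Policy X U) : ℝ≥0∞ :=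
  ⨆ x : X, ENNReal.ofReal |discountedCost β c T γ x - optimalCost β c T x|

/-- The deterministic stationary policy given by `g` is optimal for the discounted problem, from
every initial state. -/
def IsDiscountedOptimal (β : ℝ) (c : X → U → ℝ) (T : Kernel (X × U) X) [IsMarkovKernel T]
    (g : X → U) : Prop :=
  ∃ hg : Measurable g,
    ∀ x, discountedCost β c T (Policy.stationary g hg) x = optimalCost β c T x

end Control

section Regularity

/-- The Wasserstein-1 distance, as an infimum over couplings. -/
def wasserstein1 {X : Type*} [MetricSpace X] [MeasurableSpace X] (μ ν : Measure X) : ℝ≥0∞ :=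
  ⨅ (ρ : Measure (X × X)) (_ : ρ.fst = μ ∧ ρ.snd = ν), ∫⁻ p, edist p.1 p.2 ∂ρ

/-- Wasserstein-regular MDP: the cost is nonnegative, bounded by `B`, jointly continuous and
`Lc`-Lipschitz in the state, the kernel is weakly continuous and `LT`-Lipschitz in the state for
the Wasserstein-1 distance, and `β * LT < 1`. -/
structure WassersteinRegular {X : Type*} {U : Type*} [MetricSpace X] [MeasurableSpace X]
    [TopologicalSpace U] [MeasurableSpace U] (T : Kernel (X × U) X) (c : X → U → ℝ)
    (β B : ℝ) (Lc LT : ℝ≥0) : Prop where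
  compact_action : CompactSpace U
  cost_nonneg : ∀ x a, 0 ≤ c x a
  cost_le : ∀ x a, c x a ≤ B
  cost_continuous : Continuous fun p : X × U => c p.1 p.2
  kernel_continuous : ∀ f : X →ᵇ ℝ, Continuous fun p : X × U => ∫ y, f y ∂(T p)
  cost_lipschitz : ∀ a, LipschitzWith Lc fun x => c x a
  kernel_lipschitz : ∀ a x y, wasserstein1 (T (x, a)) (T (y, a)) ≤ LT * edist x y
  contraction : β * LT < 1

end Regularity

section Exploration

variable {X : Type*} {U : Type*} [MeasurableSpace X] [MeasurableSpace U]

/-- Transition kernel of the chain `Z_n = ((X_n, U_n), X_{n+1})`: from `((x, a), x')` it moves to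
`((x', a'), x'')` with `a' ∼ γ` and `x'' ∼ T(⬝ | x', a')`. -/
def augmentedKernel (T : Kernel (X × U) X) (γ : Measure U) :
    Kernel ((X × U) × X) ((X × U) × X) :=
  (((Kernel.id : Kernel X X) ×ₖ Kernel.const X γ) ⊗ₖ Kernel.prodMkLeft X T).comap
    Prod.snd measurable_snd

/-- The law of `((x, a), x')` when `x ∼ π`, `a ∼ γ` are independent and `x' ∼ T(⬝ | x, a)`. -/
def stationaryLaw (T : Kernel (X × U) X) (γ : Measure U) (π : Measure X) :
    Measure ((X × U) × X) :=
  (π.prod γ) ⊗ₘ T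

/-- The augmented chain is `ψ`-irreducible and the law `stationaryLaw T γ π` is its unique
invariant probability measure. -/
structure ErgodicExploration (T : Kernel (X × U) X) (γ : Measure U) (π : Measure X) : Prop where
  irreducible : ∃ ψ : Measure ((X × U) × X), SigmaFinite ψ ∧ ψ ≠ 0 ∧
    Kernel.IsIrreducible ψ (augmentedKernel T γ)
  invariant : Kernel.Invariant (augmentedKernel T γ) (stationaryLaw T γ π)
  unique : ∀ μ : Measure ((X × U) × X), IsProbabilityMeasure μ →
    Kernel.Invariant (augmentedKernel T γ) μ → μ = stationaryLaw T γ π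

/-- Sub-Gaussian concentration of the empirical means of `[0, 1]`-valued functions along the
observed trajectory `Y`, with constants `C₀` and `c₀`. -/
def Concentrates {Ω : Type*} [MeasurableSpace Ω] (P : Measure Ω) (Y : Ω → ℕ → X × U)
    (T : Kernel (X × U) X) (γ : Measure U) (π : Measure X) (C₀ c₀ : ℝ) : Prop :=
  ∀ f : (X × U) × X → ℝ, Measurable f → (∀ z, f z ∈ Set.Icc (0 : ℝ) 1) →
    ∀ ε : ℝ, 0 < ε → ∀ n : ℕ, 1 ≤ n →
      P.real {ω | ε ≤ |(n : ℝ)⁻¹ * ∑ t ∈ Finset.range n, f (Y ω t, (Y ω (t + 1)).1)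
          - ∫ z, f z ∂(stationaryLaw T γ π)|}
        ≤ C₀ * Real.exp (-(c₀ * n * ε ^ 2))

end Exploration

section Learning

/-! A partition of `X` into `M` bins is given by its quantizer `q : X → Fin M`; the `i`-th bin is
`q ⁻¹' {i}`. The finite model has state space `Fin M`, where `i` stands for the (representative of
the) `i`-th bin. -/

variable {X : Type*} {U : Type*} {M : ℕ}

/-- The quantization error, the largest diameter of a bin. -/
def quantizationError [MetricSpace X] (q : X → Fin M) : ℝ≥0∞ :=
  ⨆ i : Fin M, Metric.ediam (q ⁻¹' {i})

/-- The minimum over bins `i` and actions `a` of `γ_a * π(B_i)`. -/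
def minMass [MeasurableSpace X] [MeasurableSpace U] (q : X → Fin M) (γ : Measure U)
    (π : Measure X) : ℝ :=
  ⨅ p : Fin M × U, γ.real {p.2} * π.real (q ⁻¹' {p.1})

open Classical in
/-- The times `n < N` at which the `i`-th bin is visited and action `a` is used. -/
def visits (q : X → Fin M) (N : ℕ) (z : ℕ → X × U) (i : Fin M) (a : U) : Finset ℕ :=
  (Finset.range N).filter fun n => q (z n).1 = i ∧ (z n).2 = a

/-- The learned cost; it is `0` if the pair `(i, a)` has not been visited, as division by zero
gives zero. -/
def learnedCost (c : X → U → ℝ) (q : X → Fin M) (N : ℕ) (z : ℕ → X × U) (i : Fin M) (a : U) : ℝ :=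
  (∑ n ∈ visits q N z i a, c (z n).1 (z n).2) / (visits q N z i a).card

/-- The learned probability of moving from bin `i` to bin `j` under action `a`; if the pair `(i, a)`
has not been visited, the state `i` is made absorbing under `a`. -/
def learnedProb (q : X → Fin M) (N : ℕ) (z : ℕ → X × U) (i : Fin M) (a : U) (j : Fin M) : ℝ :=
  if visits q N z i a = ∅ then (if j = i then 1 else 0)
  else (((visits q N z i a).filter fun n => q (z (n + 1)).1 = j).card : ℝ) /
    (visits q N z i a).card

theorem learnedProb_nonneg (q : X → Fin M) (N : ℕ) (z : ℕ → X × U) (i : Fin M) (a : U)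
    (j : Fin M) : 0 ≤ learnedProb q N z i a j := by
  unfold learnedProb
  split_ifs <;> positivity

theorem sum_learnedProb (q : X → Fin M) (N : ℕ) (z : ℕ → X × U) (i : Fin M) (a : U) :
    ∑ j, learnedProb q N z i a j = 1 := by
  unfold learnedProb
  by_cases h : visits q N z i a = ∅
  · simp [h]
  · have hc : ((visits q N z i a).card : ℝ) ≠ 0 := by
      simpa using h
    simp only [h, if_false]
    rw [← Finset.sum_div, ← Nat.cast_sum, div_eq_one_iff_eq hc]
    norm_cast
    exact (Finset.card_eq_sum_card_fiberwise (fun _ _ => Finset.mem_coe.2 (Finset.mem_univ _))).symm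

/-- The learned transition kernel on the finite state space. -/
def learnedKernel [Finite U] [MeasurableSpace U] [MeasurableSingletonClass U]
    (q : X → Fin M) (N : ℕ) (z : ℕ → X × U) : Kernel (Fin M × U) (Fin M) :=
  Kernel.ofFunOfCountable fun p =>
    ∑ j, ENNReal.ofReal (learnedProb q N z p.1 p.2 j) • Measure.dirac j

instance [Finite U] [MeasurableSpace U] [MeasurableSingletonClass U]
    (q : X → Fin M) (N : ℕ) (z : ℕ → X × U) : IsMarkovKernel (learnedKernel q N z) where
  isProbabilityMeasure p := by
    refine ⟨?_⟩
    change (∑ j, ENNReal.ofReal (learnedProb q N z p.1 p.2 j) • Measure.dirac j) Set.univ = 1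
    simp only [Measure.coe_finsetSum, Finset.sum_apply, Measure.smul_apply, measure_univ,
      smul_eq_mul, mul_one]
    rw [← ENNReal.ofReal_sum_of_nonneg fun j _ => learnedProb_nonneg q N z p.1 p.2 j,
      sum_learnedProb, ENNReal.ofReal_one]

end Learning

end QuantizedMDP

end

/-! Let `V` be the bounded solution of the Bellman equation of the true model. It is the optimal
cost, and it is Lipschitz with the constant `L` that solves `L = Lc + β * LT * L`, since the Bellman
operator preserves that bound. Everything rests on comparing one-step state-action values with this
single function `V`.

Let `W` solve the Bellman equation of the learned model on the bins. The learned kernel integrates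
`W` by averaging it over the observed successors of a cell (a bin together with an action).
Replacing `W` by `V` at these successors costs at most `β * sup |W ∘ q - V|`. What remains is an
error `η`: the variation of the cost over a bin, plus `β` times the distance from the empirical
average of `V` over the cell to the true conditional mean. By contraction `sup |W ∘ q - V| ≤ η / (1
- β)`, and the greedy policy of `W`, extended to `X`, loses at most `2 * η / (1 - β) ^ 2`
(`robustnessError_le_of_aggregation`). An optimal learned policy is greedy by the performance
difference identity.

As `V` does not depend on the data, no uniform law over a class of functions is needed. The
empirical average of `V` in a cell is a ratio of two empirical means, so `2 * M * |U|` fixed `[0,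
1]`-valued test functions suffice. If all their deviations are at most `d`, then `η` is at most `L`
times the quantization error plus a multiple of `d / κ`, with `κ` the minimal cell mass
(`abs_average_sub_le`). The maximal inequality `lintegral_iSup_ofReal_le` bounds the expected
largest deviation by a multiple of `√(log (M * |U|) / N)`.

If some cell is never visited, the deviation of its indicator is at least `κ`. A union bound over
cells, with the trivial bound on the error, gives the exponential term. -/

noncomputable section

namespace QuantizedMDP

/-! ### Marginals of the controlled process -/

section PathLaw

variable {X : Type*} {U : Type*} [MeasurableSpace X] [MeasurableSpace U]

instance (T : Kernel (X × U) X) [IsMarkovKernel T] (γ : Policy X U) (ν : Measure X)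
    [IsProbabilityMeasure ν] : IsProbabilityMeasure (pathLaw T γ ν) := by
  unfold pathLaw
  infer_instance

theorem pathLaw_map_zero (T : Kernel (X × U) X) [IsMarkovKernel T] (γ : Policy X U)
    (ν : Measure X) [IsProbabilityMeasure ν] :
    (pathLaw T γ ν).map (fun z => z 0) = ν ⊗ₘ γ.first := by
  unfold pathLaw Kernel.trajMeasure
  have h : (fun z : ℕ → X × U => z 0) = (MeasurableEquiv.piUnique (fun i : Finset.Iic 0 => X × U))
      ∘ Preorder.frestrictLe (π := fun _ : ℕ => X × U) 0 := rfl
  rw [h, ← Measure.map_map (by fun_prop) (by fun_prop), Measure.map_comp _ _ (by fun_prop),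
    Kernel.traj_map_frestrictLe, Kernel.partialTraj_self, Measure.id_comp,
    Measure.map_map (by fun_prop) (by fun_prop)]
  exact (congrArg (fun f => (ν ⊗ₘ γ.first).map f) (Equiv.self_comp_symm _)).trans Measure.map_id

theorem pathLaw_map_succ (T : Kernel (X × U) X) [IsMarkovKernel T] (γ : Policy X U)
    (ν : Measure X) [IsProbabilityMeasure ν] (n : ℕ) :
    (pathLaw T γ ν).map (fun z => z (n + 1)) =
      Policy.stepKernel T γ n ∘ₘ (pathLaw T γ ν).map
        (Preorder.frestrictLe (π := fun _ : ℕ => X × U) n) := by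
  have h := congrArg (Measure.map Prod.snd)
    (Kernel.map_frestrictLe_trajMeasure_compProd_eq_map_trajMeasure (X := fun _ => X × U)
    (μ₀ := ν ⊗ₘ γ.first) (κ := Policy.stepKernel T γ) (a := n))
  rw [Measure.map_map (by fun_prop) (by fun_prop), ← Measure.snd, Measure.snd_compProd] at h
  exact h.symm

/-- The next state is drawn before the next action, so forgetting that action leaves `T` at the
current pair, however the policy uses the history. -/
theorem pathLaw_map_fst_succ (T : Kernel (X × U) X) [IsMarkovKernel T] (γ : Policy X U)
    (ν : Measure X) [IsProbabilityMeasure ν] (n : ℕ) :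
    (pathLaw T γ ν).map (fun z => (z (n + 1)).1) = T ∘ₘ (pathLaw T γ ν).map (fun z => z n) := by
  have h : (fun z : ℕ → X × U => (z (n + 1)).1) = Prod.fst ∘ fun z => z (n + 1) := rfl
  have h' : (fun z : ℕ → X × U => z n) =
    (fun h : Finset.Iic n → X × U => h ⟨n, Finset.mem_Iic.2 le_rfl⟩) ∘
      Preorder.frestrictLe (π := fun _ : ℕ => X × U) n := rfl
  rw [h, ← Measure.map_map (by fun_prop) (by fun_prop), pathLaw_map_succ,
    Measure.map_comp _ _ (by fun_prop), h', ← Measure.map_map (by fun_prop) (by fun_prop)]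
  unfold Policy.stepKernel
  rw [← Kernel.fst_eq, Kernel.fst_compProd, ← Kernel.comp_deterministic_eq_comap,
    ← Measure.comp_assoc, Measure.deterministic_comp_eq_map]

/-- Given the past, the action is a Dirac mass at `g` of the state. Countability of `U` makes the
graph of `g` measurable. -/
theorem pathLaw_stationary_ae [Countable U] [MeasurableSingletonClass U]
    (T : Kernel (X × U) X) [IsMarkovKernel T] (g : X → U) (hg : Measurable g)
    (ν : Measure X) [IsProbabilityMeasure ν] (n : ℕ) :
    ∀ᵐ z ∂(pathLaw T (Policy.stationary g hg) ν), (z n).2 = g (z n).1 := by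
  have hm : MeasurableSet {p : X × U | p.2 = g p.1} :=
    measurableSet_eq_fun measurable_snd (hg.comp measurable_fst)
  suffices h : ∀ᵐ p ∂((pathLaw T (Policy.stationary g hg) ν).map fun z => z n), p.2 = g p.1 from
    ae_of_ae_map (measurable_pi_apply n).aemeasurable h
  cases n with
  | zero =>
    rw [pathLaw_map_zero, Measure.ae_compProd_iff hm]
    refine .of_forall fun x => ?_
    simp [Policy.stationary, Kernel.deterministic_apply]
  | succ n =>
    rw [pathLaw_map_succ]
    refine Measure.ae_comp_of_ae_ae hm (.of_forall fun h => ?_)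
    unfold Policy.stepKernel
    rw [Kernel.ae_compProd_iff hm]
    refine .of_forall fun x => ?_
    simp [Policy.stationary, Kernel.deterministic_apply]

end PathLaw

/-! ### Performance difference identity and verification -/

section Verification

variable {X : Type*} {U : Type*} [MeasurableSpace X] [MeasurableSpace U]

/-- The expected cost of using action `a` in state `x` when `V` is the cost to go. -/
def stateActionValue (β : ℝ) (c : X → U → ℝ) (T : Kernel (X × U) X) (V : X → ℝ) (x : X) (a : U) :
    ℝ :=
  c x a + β * ∫ y, V y ∂(T (x, a))

variable {β : ℝ} {c : X → U → ℝ} {T : Kernel (X × U) X} {V : X → ℝ} {K L : ℝ}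

theorem abs_integral_le_of_abs_le {Z : Type*} [MeasurableSpace Z] (μ : Measure Z)
    [IsProbabilityMeasure μ] {f : Z → ℝ} (hf : ∀ z, |f z| ≤ K) : |∫ z, f z ∂μ| ≤ K := by
  simpa using norm_integral_le_of_norm_le_const (μ := μ) (f := f) (C := K) (.of_forall hf)

theorem integrable_of_abs_le {Z : Type*} [MeasurableSpace Z] (μ : Measure Z)
    [IsFiniteMeasure μ] {f : Z → ℝ} (hm : Measurable f) (hf : ∀ z, |f z| ≤ K) :
    Integrable f μ :=
  Integrable.of_bound hm.aestronglyMeasurable K (.of_forall hf)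

theorem summable_pow_mul_of_abs_le (hβ₀ : 0 ≤ β) (hβ₁ : β < 1) {f : ℕ → ℝ} (hf : ∀ t, |f t| ≤ K) :
    Summable fun t => β ^ t * f t := by
  refine Summable.of_norm_bounded ((summable_geometric_of_lt_one hβ₀ hβ₁).mul_right K) fun t => ?_
  rw [norm_mul, norm_pow, Real.norm_of_nonneg hβ₀]
  exact mul_le_mul_of_nonneg_left (hf t) (by positivity)

theorem measurable_stateActionValue (hc : Measurable fun p : X × U => c p.1 p.2)
    (hV : Measurable V) : Measurable fun p : X × U => stateActionValue β c T V p.1 p.2 := by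
  unfold stateActionValue
  exact hc.add ((hV.stronglyMeasurable.integral_kernel (κ := T)).measurable.const_mul β)

variable [IsMarkovKernel T]

theorem integral_state_initial (γ : Policy X U) (x : X) {f : X → ℝ} (hf : Measurable f) :
    ∫ z, f (z 0).1 ∂(pathLaw T γ (Measure.dirac x)) = f x := by
  have hm : Measurable fun z : ℕ → X × U => (z 0).1 := by fun_prop
  have h := congrArg (Measure.map Prod.fst) (pathLaw_map_zero T γ (Measure.dirac x))
  rw [Measure.map_map (by fun_prop) (by fun_prop), ← Measure.fst, Measure.fst_compProd] at h
  rw [← integral_map (φ := fun z : ℕ → X × U => (z 0).1) hm.aemeasurable hf.aestronglyMeasurable]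
  exact (congrArg (fun μ => ∫ y, f y ∂μ) h).trans (integral_dirac' _ _ hf.stronglyMeasurable)

theorem integral_state_succ (γ : Policy X U) (ν : Measure X) [IsProbabilityMeasure ν]
    (hV : Measurable V) (hVL : ∀ x, |V x| ≤ L) (t : ℕ) :
    ∫ z, V (z (t + 1)).1 ∂(pathLaw T γ ν) = ∫ z, ∫ y, V y ∂(T (z t)) ∂(pathLaw T γ ν) := by
  have h := congrArg (fun μ => ∫ y, V y ∂μ) (pathLaw_map_fst_succ T γ ν t)
  have : IsProbabilityMeasure ((pathLaw T γ ν).map fun z => z t) :=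
    Measure.isProbabilityMeasure_map (measurable_pi_apply t).aemeasurable
  have hm : Measurable fun z : ℕ → X × U => (z (t + 1)).1 := by fun_prop
  beta_reduce at h
  rw [integral_map hm.aemeasurable hV.aestronglyMeasurable,
    ← Measure.snd_compProd, Measure.snd, integral_map (by fun_prop) hV.aestronglyMeasurable,
    Measure.integral_compProd (f := fun p : (X × U) × X => V p.2)
      (integrable_of_abs_le _ (hV.comp measurable_snd) fun _ => hVL _),
    integral_map (measurable_pi_apply t).aemeasurable
      (hV.stronglyMeasurable.integral_kernel (κ := T)).aestronglyMeasurable] at h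
  exact h

theorem discountedCost_eq_tsum (hβ₀ : 0 ≤ β) (hβ₁ : β < 1)
    (hc : Measurable fun p : X × U => c p.1 p.2) (hcK : ∀ x a, |c x a| ≤ K)
    (γ : Policy X U) (x : X) :
    discountedCost β c T γ x =
      ∑' t : ℕ, β ^ t * ∫ z, c (z t).1 (z t).2 ∂(pathLaw T γ (Measure.dirac x)) := by
  have hm (t : ℕ) : Measurable fun z : ℕ → X × U => c (z t).1 (z t).2 :=
    hc.comp (measurable_pi_apply t)
  unfold discountedCost
  rw [← integral_tsum_of_summable_integral_norm]
  · simp_rw [integral_const_mul]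
  · exact fun t => (integrable_of_abs_le _ (hm t) fun z => hcK _ _).const_mul _
  · simp_rw [norm_mul, integral_const_mul, norm_pow, Real.norm_of_nonneg hβ₀]
    refine summable_pow_mul_of_abs_le (K := K) hβ₀ hβ₁ fun t => ?_
    exact abs_integral_le_of_abs_le _ fun z => by simpa using hcK _ _

/-- The performance difference identity. -/
theorem discountedCost_eq_add_tsum (hβ₀ : 0 ≤ β) (hβ₁ : β < 1)
    (hc : Measurable fun p : X × U => c p.1 p.2) (hcK : ∀ x a, |c x a| ≤ K)
    (hV : Measurable V) (hVL : ∀ x, |V x| ≤ L) (γ : Policy X U) (x : X) :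
    discountedCost β c T γ x = V x + ∑' t : ℕ, β ^ t *
      ∫ z, (stateActionValue β c T V (z t).1 (z t).2 - V (z t).1)
        ∂(pathLaw T γ (Measure.dirac x)) := by
  set P := pathLaw T γ (Measure.dirac x) with hP
  have hmc (t : ℕ) : Measurable fun z : ℕ → X × U => c (z t).1 (z t).2 :=
    hc.comp (measurable_pi_apply t)
  have hmV (t : ℕ) : Measurable fun z : ℕ → X × U => V (z t).1 := by fun_prop
  have hmT (t : ℕ) : Measurable fun z : ℕ → X × U => ∫ y, V y ∂(T (z t)) :=
    (hV.stronglyMeasurable.integral_kernel (κ := T)).measurable.comp (measurable_pi_apply t)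
  have hic (t : ℕ) : Integrable (fun z : ℕ → X × U => c (z t).1 (z t).2) P :=
    integrable_of_abs_le P (hmc t) fun z => hcK _ _
  have hiV (t : ℕ) : Integrable (fun z : ℕ → X × U => V (z t).1) P :=
    integrable_of_abs_le P (hmV t) fun z => hVL _
  have hiT (t : ℕ) : Integrable (fun z : ℕ → X × U => ∫ y, V y ∂(T (z t))) P :=
    integrable_of_abs_le P (hmT t) fun z => abs_integral_le_of_abs_le _ hVL
  have hstep (t : ℕ) : ∫ z, (stateActionValue β c T V (z t).1 (z t).2 - V (z t).1) ∂P =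
      ∫ z, c (z t).1 (z t).2 ∂P + β * ∫ z, V (z (t + 1)).1 ∂P - ∫ z, V (z t).1 ∂P := by
    have h1 := integral_sub ((hic t).add ((hiT t).const_mul β)) (hiV t)
    have h2 := integral_add (hic t) ((hiT t).const_mul β)
    rw [integral_const_mul, ← integral_state_succ γ _ hV hVL t] at h2
    rw [← h2]
    exact h1
  have hsc : Summable fun t => β ^ t * ∫ z, c (z t).1 (z t).2 ∂P :=
    summable_pow_mul_of_abs_le hβ₀ hβ₁ fun t => abs_integral_le_of_abs_le _ fun z => hcK _ _
  have hsV : Summable fun t => β ^ t * ∫ z, V (z t).1 ∂P :=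
    summable_pow_mul_of_abs_le hβ₀ hβ₁ fun t => abs_integral_le_of_abs_le _ fun z => hVL _
  have h0 : ∫ z, V (z 0).1 ∂P = V x := integral_state_initial γ x hV
  rw [discountedCost_eq_tsum hβ₀ hβ₁ hc hcK, ← hP]
  -- The terms in `V` telescope: only `-V x` from time `0` survives in the sum, and it cancels the
  -- leading `V x`.
  have hterm (t : ℕ) : β ^ t * ∫ z, (stateActionValue β c T V (z t).1 (z t).2 - V (z t).1) ∂P =
      β ^ t * ∫ z, c (z t).1 (z t).2 ∂P +
        (β ^ (t + 1) * ∫ z, V (z (t + 1)).1 ∂P - β ^ t * ∫ z, V (z t).1 ∂P) := by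
    rw [hstep]; ring
  simp_rw [hterm]
  have hsV' : Summable fun t => β ^ (t + 1) * ∫ z, V (z (t + 1)).1 ∂P :=
    (summable_nat_add_iff 1).2 hsV
  rw [hsc.tsum_add (hsV'.sub hsV), hsV'.tsum_sub hsV, hsV.tsum_eq_zero_add, h0]
  simp

theorem tsum_pow_mul_le (hβ₀ : 0 ≤ β) (hβ₁ : β < 1) {f : ℕ → ℝ} (hf : ∀ t, |f t| ≤ K) {e : ℝ}
    (he : ∀ t, f t ≤ e) : ∑' t, β ^ t * f t ≤ e / (1 - β) := by
  have h := (hasSum_geometric_of_lt_one hβ₀ hβ₁).mul_right e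
  rw [div_eq_inv_mul, ← h.tsum_eq]
  exact (summable_pow_mul_of_abs_le hβ₀ hβ₁ hf).tsum_le_tsum
    (fun t => mul_le_mul_of_nonneg_left (he t) (by positivity)) h.summable

theorem abs_discountedCost_le (hβ₀ : 0 ≤ β) (hβ₁ : β < 1)
    (hc : Measurable fun p : X × U => c p.1 p.2) (hcK : ∀ x a, |c x a| ≤ K) (γ : Policy X U)
    (x : X) : |discountedCost β c T γ x| ≤ K / (1 - β) := by
  have hb (t : ℕ) : |∫ z, c (z t).1 (z t).2 ∂(pathLaw T γ (Measure.dirac x))| ≤ K :=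
    abs_integral_le_of_abs_le _ fun z => hcK _ _
  rw [discountedCost_eq_tsum hβ₀ hβ₁ hc hcK, abs_le']
  refine ⟨tsum_pow_mul_le hβ₀ hβ₁ hb fun t => le_of_abs_le (hb t), ?_⟩
  rw [← tsum_neg]
  simp_rw [← mul_neg]
  exact tsum_pow_mul_le (K := K) hβ₀ hβ₁ (fun t => by rw [abs_neg]; exact hb t)
    fun t => neg_le.1 (neg_le_of_abs_le (hb t))

theorem abs_stateActionValue_sub_le (hβ₀ : 0 ≤ β) (hβ₁ : β < 1) (hcK : ∀ x a, |c x a| ≤ K)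
    (hVL : ∀ x, |V x| ≤ L) (x : X) (a : U) :
    |stateActionValue β c T V x a - V x| ≤ K + 2 * L := by
  have h1 := abs_le.1 (hcK x a)
  have h2 := abs_le.1 (hVL x)
  have h3 := abs_integral_le_of_abs_le (T (x, a)) hVL
  have h4 : |β * ∫ y, V y ∂(T (x, a))| ≤ L := by
    rw [abs_mul, abs_of_nonneg hβ₀]
    nlinarith [abs_nonneg (∫ y, V y ∂(T (x, a)))]
  have h5 := abs_le.1 h4
  unfold stateActionValue
  rw [abs_le]
  constructor <;> linarith

/-- Every term of the performance difference series is nonnegative, also for history-dependent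
policies. -/
theorem le_discountedCost (hβ₀ : 0 ≤ β) (hβ₁ : β < 1)
    (hc : Measurable fun p : X × U => c p.1 p.2) (hcK : ∀ x a, |c x a| ≤ K)
    (hV : Measurable V) (hVL : ∀ x, |V x| ≤ L) (h : ∀ x a, V x ≤ stateActionValue β c T V x a)
    (γ : Policy X U) (x : X) : V x ≤ discountedCost β c T γ x := by
  rw [discountedCost_eq_add_tsum hβ₀ hβ₁ hc hcK hV hVL]
  refine le_add_of_nonneg_right (tsum_nonneg fun t => mul_nonneg (by positivity) ?_)
  exact integral_nonneg fun z => sub_nonneg.2 (h _ _)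

section Stationary

variable [Countable U] [MeasurableSingletonClass U]

theorem discountedCost_stationary_eq_add_tsum (hβ₀ : 0 ≤ β) (hβ₁ : β < 1)
    (hc : Measurable fun p : X × U => c p.1 p.2) (hcK : ∀ x a, |c x a| ≤ K)
    (hV : Measurable V) (hVL : ∀ x, |V x| ≤ L) (g : X → U) (hg : Measurable g) (x : X) :
    discountedCost β c T (Policy.stationary g hg) x = V x + ∑' t : ℕ, β ^ t *
      ∫ z, (stateActionValue β c T V (z t).1 (g (z t).1) - V (z t).1)
        ∂(pathLaw T (Policy.stationary g hg) (Measure.dirac x)) := by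
  rw [discountedCost_eq_add_tsum hβ₀ hβ₁ hc hcK hV hVL]
  congr 2 with t
  congr 1
  refine integral_congr_ae ?_
  filter_upwards [pathLaw_stationary_ae T g hg (Measure.dirac x) t] with z hz
  rw [hz]

/-- A one-step loss of at most `e` at every time accumulates to the geometric series `e / (1 - β)`.
-/
theorem discountedCost_stationary_le (hβ₀ : 0 ≤ β) (hβ₁ : β < 1)
    (hc : Measurable fun p : X × U => c p.1 p.2) (hcK : ∀ x a, |c x a| ≤ K)
    (hV : Measurable V) (hVL : ∀ x, |V x| ≤ L) (g : X → U) (hg : Measurable g) {e : ℝ}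
    (h : ∀ x, stateActionValue β c T V x (g x) ≤ V x + e) (x : X) :
    discountedCost β c T (Policy.stationary g hg) x ≤ V x + e / (1 - β) := by
  rw [discountedCost_stationary_eq_add_tsum hβ₀ hβ₁ hc hcK hV hVL]
  refine add_le_add_right (tsum_pow_mul_le (K := K + 2 * L) hβ₀ hβ₁ (fun t => ?_) fun t => ?_) _
  · exact abs_integral_le_of_abs_le _ fun z => abs_stateActionValue_sub_le hβ₀ hβ₁ hcK hVL _ _
  · have hm : Measurable fun y => stateActionValue β c T V y (g y) - V y :=
      ((measurable_stateActionValue hc hV).comp (measurable_id.prodMk hg)).sub hV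
    have hi : Integrable (fun z : ℕ → X × U => stateActionValue β c T V (z t).1 (g (z t).1)
        - V (z t).1) (pathLaw T (Policy.stationary g hg) (Measure.dirac x)) :=
      integrable_of_abs_le _ (hm.comp (by fun_prop : Measurable fun z : ℕ → X × U => (z t).1))
        fun z => abs_stateActionValue_sub_le hβ₀ hβ₁ hcK hVL _ _
    have h1 := integral_mono hi (integrable_const e) fun z => by
      have := h (z t).1
      simp only
      linarith
    simpa using h1

/-- Verification: a bounded solution of the Bellman equation is the optimal cost. -/
theorem optimalCost_eq (hβ₀ : 0 ≤ β) (hβ₁ : β < 1)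
    (hc : Measurable fun p : X × U => c p.1 p.2) (hcK : ∀ x a, |c x a| ≤ K)
    (hV : Measurable V) (hVL : ∀ x, |V x| ≤ L) (h : ∀ x a, V x ≤ stateActionValue β c T V x a)
    (g : X → U) (hg : Measurable g) (hgV : ∀ x, stateActionValue β c T V x (g x) = V x) (x : X) :
    optimalCost β c T x = V x := by
  have hle := le_discountedCost hβ₀ hβ₁ hc hcK hV hVL h
  have : Nonempty (Policy X U) := ⟨Policy.stationary g hg⟩
  refine le_antisymm ?_ (le_ciInf fun γ => hle γ x)
  refine (ciInf_le ⟨V x, ?_⟩ (Policy.stationary g hg)).trans ?_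
  · rintro _ ⟨γ, rfl⟩
    exact hle γ x
  · simpa using discountedCost_stationary_le hβ₀ hβ₁ hc hcK hV hVL g hg (e := 0)
      (fun x => by simp [hgV]) x

/-- An optimal stationary policy is greedy for the optimal cost. -/
theorem stateActionValue_eq_of_discountedCost_eq (hβ₀ : 0 ≤ β) (hβ₁ : β < 1)
    (hc : Measurable fun p : X × U => c p.1 p.2) (hcK : ∀ x a, |c x a| ≤ K)
    (hV : Measurable V) (hVL : ∀ x, |V x| ≤ L) (h : ∀ x a, V x ≤ stateActionValue β c T V x a)
    (g : X → U) (hg : Measurable g) (x : X)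
    (hopt : discountedCost β c T (Policy.stationary g hg) x = V x) :
    stateActionValue β c T V x (g x) = V x := by
  set P := pathLaw T (Policy.stationary g hg) (Measure.dirac x) with hP
  rw [discountedCost_stationary_eq_add_tsum hβ₀ hβ₁ hc hcK hV hVL, ← hP] at hopt
  have hnn (t : ℕ) : 0 ≤ ∫ z, (stateActionValue β c T V (z t).1 (g (z t).1) - V (z t).1) ∂P :=
    integral_nonneg fun z => sub_nonneg.2 (h _ _)
  have hs : Summable fun t => β ^ t *
      ∫ z, (stateActionValue β c T V (z t).1 (g (z t).1) - V (z t).1) ∂P :=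
    summable_pow_mul_of_abs_le (K := K + 2 * L) hβ₀ hβ₁ fun t =>
      abs_integral_le_of_abs_le _ fun z => abs_stateActionValue_sub_le hβ₀ hβ₁ hcK hVL _ _
  -- The nonnegative terms sum to zero. The term at time `0` is the Bellman residual at `x` itself,
  -- so optimality from `x` forces greediness at `x`.
  have h0 := hs.le_tsum 0 fun t _ => mul_nonneg (by positivity) (hnn t)
  have hm : Measurable fun y => stateActionValue β c T V y (g y) - V y :=
    ((measurable_stateActionValue hc hV).comp (measurable_id.prodMk hg)).sub hV
  rw [integral_state_initial (Policy.stationary g hg) x hm] at h0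
  have := h x (g x)
  simp only [pow_zero, one_mul] at h0
  linarith

end Stationary

theorem _root_.ProbabilityTheory.Kernel.eq_of_subsingleton {Z : Type*} [MeasurableSpace Z]
    [Subsingleton U] (κ η : Kernel Z U) [IsMarkovKernel κ] [IsMarkovKernel η] : κ = η := by
  ext z s -
  rcases s.eq_empty_or_nonempty with rfl | hs
  · simp
  · rw [Subsingleton.eq_univ_of_nonempty hs, measure_univ, measure_univ]

instance [Subsingleton U] : Subsingleton (Policy X U) where
  allEq := by
    rintro ⟨f, n, hf, hn⟩ ⟨f', n', hf', hn'⟩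
    obtain rfl : f = f' := Kernel.eq_of_subsingleton f f'
    obtain rfl : n = n' := funext fun k => Kernel.eq_of_subsingleton (n k) (n' k)
    rfl

/-- With a single action all policies coincide. This removes the case `M * |U| = 1`, where the
logarithm in the bound vanishes. -/
theorem robustnessError_eq_zero_of_subsingleton [Subsingleton U] (β : ℝ) (c : X → U → ℝ)
    (T : Kernel (X × U) X) [IsMarkovKernel T] (γ : Policy X U) : robustnessError β c T γ = 0 := by
  have : Nonempty (Policy X U) := ⟨γ⟩
  have h (x : X) : optimalCost β c T x = discountedCost β c T γ x := by
    unfold optimalCost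
    simp [Subsingleton.elim _ γ]
  simp [robustnessError, h]

end Verification

/-! ### Fixed point of the Bellman operator -/

section Bellman

theorem abs_inf'_sub_inf'_le {ι : Type*} (s : Finset ι) (hs : s.Nonempty) {f g : ι → ℝ} {e : ℝ}
    (h : ∀ i ∈ s, |f i - g i| ≤ e) : |s.inf' hs f - s.inf' hs g| ≤ e := by
  obtain ⟨i, hi, hfi⟩ := s.exists_mem_eq_inf' hs f
  obtain ⟨j, hj, hgj⟩ := s.exists_mem_eq_inf' hs g
  have h1 := s.inf'_le f hj
  have h2 := s.inf'_le g hi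
  have h3 := abs_le.1 (h i hi)
  have h4 := abs_le.1 (h j hj)
  rw [abs_le]
  constructor <;> linarith

variable {X : Type*} {U : Type*} [TopologicalSpace X] [MeasurableSpace X] [OpensMeasurableSpace X]
  [MeasurableSpace U] [Fintype U] [Nonempty U] {β : ℝ} {c : X → U → ℝ} {T : Kernel (X × U) X}
  [IsMarkovKernel T] {K : ℝ}

/-- The Bellman optimality operator on bounded continuous functions. -/
def bellmanOperator (hβ₀ : 0 ≤ β) (hc : ∀ a, Continuous fun x => c x a)
    (hcK : ∀ x a, |c x a| ≤ K)
    (hT : ∀ (f : X →ᵇ ℝ) (a : U), Continuous fun x => ∫ y, f y ∂(T (x, a))) (V : X →ᵇ ℝ) :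
    X →ᵇ ℝ :=
  BoundedContinuousFunction.ofNormedAddCommGroup
    (fun x => Finset.univ.inf' Finset.univ_nonempty fun a => stateActionValue β c T V x a)
    (Continuous.finset_inf'_apply _ fun a _ => (hc a).add ((hT V a).const_mul β))
    (K + β * ‖V‖) fun x => by
      obtain ⟨a, -, ha⟩ := Finset.univ.exists_mem_eq_inf' Finset.univ_nonempty
        fun a => stateActionValue β c T V x a
      rw [ha]
      refine (norm_add_le _ _).trans (add_le_add (hcK x a) ?_)
      rw [norm_mul, Real.norm_of_nonneg hβ₀]
      exact mul_le_mul_of_nonneg_left (abs_integral_le_of_abs_le _ V.norm_coe_le_norm) hβ₀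

variable (hβ₀ : 0 ≤ β) (hβ₁ : β < 1) (hc : ∀ a, Continuous fun x => c x a)
  (hcK : ∀ x a, |c x a| ≤ K)
  (hT : ∀ (f : X →ᵇ ℝ) (a : U), Continuous fun x => ∫ y, f y ∂(T (x, a)))

omit [OpensMeasurableSpace X] in
theorem bellmanOperator_apply (V : X →ᵇ ℝ) (x : X) :
    bellmanOperator hβ₀ hc hcK hT V x =
      Finset.univ.inf' Finset.univ_nonempty fun a => stateActionValue β c T V x a := rfl

theorem integrable_boundedContinuous (f : X →ᵇ ℝ) (μ : Measure X) [IsFiniteMeasure μ] :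
    Integrable f μ :=
  integrable_of_abs_le μ f.continuous.measurable f.norm_coe_le_norm

include hβ₁ in
-- Minima and averages are nonexpansive for the sup norm; only the factor `β` remains.
theorem contractingWith_bellmanOperator :
    ContractingWith ⟨β, hβ₀⟩ (bellmanOperator hβ₀ hc hcK hT) := by
  refine ⟨by exact_mod_cast hβ₁, LipschitzWith.of_dist_le_mul fun V W => ?_⟩
  refine (BoundedContinuousFunction.dist_le (by positivity)).2 fun x => ?_
  rw [Real.dist_eq, bellmanOperator_apply, bellmanOperator_apply]
  refine abs_inf'_sub_inf'_le _ _ fun a _ => ?_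
  have h : stateActionValue β c T V x a - stateActionValue β c T W x a =
      β * ∫ y, (V y - W y) ∂(T (x, a)) := by
    unfold stateActionValue
    rw [integral_sub (integrable_boundedContinuous _ _) (integrable_boundedContinuous _ _)]
    ring
  rw [h, abs_mul, abs_of_nonneg hβ₀]
  refine mul_le_mul_of_nonneg_left (abs_integral_le_of_abs_le _ fun y => ?_) hβ₀
  exact BoundedContinuousFunction.dist_coe_le_dist (f := V) (g := W) y

include hβ₁ in
-- The fixed point is the limit of the iterates started at `0`, so it inherits any closed invariant
-- property. `S` carries the Lipschitz bound for the true model and is everything for the learned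
-- one.
theorem exists_bellman_solution (S : Set (X →ᵇ ℝ)) (hS : IsClosed S) (h0 : 0 ∈ S)
    (hinv : ∀ V ∈ S, bellmanOperator hβ₀ hc hcK hT V ∈ S) :
    ∃ V ∈ S, ∀ x, V x =
      Finset.univ.inf' Finset.univ_nonempty fun a => stateActionValue β c T V x a := by
  have h := contractingWith_bellmanOperator hβ₀ hβ₁ hc hcK hT
  refine ⟨h.fixedPoint, ?_, fun x => ?_⟩
  · refine hS.mem_of_tendsto (h.tendsto_iterate_fixedPoint 0) (.of_forall fun n => ?_)
    induction n with
    | zero => exact h0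
    | succ n ih => rw [Function.iterate_succ_apply']; exact hinv _ ih
  · rw [← bellmanOperator_apply hβ₀ hc hcK hT, h.fixedPoint_isFixedPt]

end Bellman

/-! ### Integrals of Lipschitz functions and couplings -/

section Wasserstein

variable {X : Type*} [MetricSpace X] [MeasurableSpace X] [OpensMeasurableSpace X]

/-- The easy half of Kantorovich-Rubinstein duality. -/
theorem ofReal_abs_integral_sub_le_wasserstein1 (f : X →ᵇ ℝ) {L : ℝ≥0} (hf : LipschitzWith L f)
    (μ ν : Measure X) [IsProbabilityMeasure μ] [IsProbabilityMeasure ν] :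
    ENNReal.ofReal |∫ x, f x ∂μ - ∫ x, f x ∂ν| ≤ L * wasserstein1 μ ν := by
  suffices h : ∀ ρ : Measure (X × X), ρ.fst = μ ∧ ρ.snd = ν →
      ENNReal.ofReal |∫ x, f x ∂μ - ∫ x, f x ∂ν| ≤ L * ∫⁻ p, edist p.1 p.2 ∂ρ by
    -- Moving `L` inside the infimum uses `L ≠ 0`; for `L = 0` the product coupling already gives
    -- the claim.
    rcases eq_or_ne L 0 with rfl | hL
    · have := h (μ.prod ν) ⟨Measure.fst_prod, Measure.snd_prod⟩
      simpa using this
    · have hL' : (L : ℝ≥0∞) ≠ 0 := by exact_mod_cast hL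
      unfold wasserstein1
      simp_rw [ENNReal.mul_iInf_of_ne hL' ENNReal.coe_ne_top]
      exact le_iInf₂ h
  intro ρ
  rintro ⟨rfl, rfl⟩
  have hρ : IsProbabilityMeasure ρ := ⟨by rw [← Measure.fst_univ]; exact measure_univ⟩
  have hm := f.continuous.measurable
  have hi₁ : Integrable (fun p : X × X => f p.1) ρ :=
    integrable_of_abs_le _ (hm.comp measurable_fst) fun _ => f.norm_coe_le_norm _
  have hi₂ : Integrable (fun p : X × X => f p.2) ρ :=
    integrable_of_abs_le _ (hm.comp measurable_snd) fun _ => f.norm_coe_le_norm _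
  rw [Measure.fst, Measure.snd, integral_map (by fun_prop) hm.aestronglyMeasurable,
    integral_map (by fun_prop) hm.aestronglyMeasurable,
    ← integral_sub hi₁ hi₂,
    ← lintegral_const_mul' _ _ ENNReal.coe_ne_top, ← Real.enorm_eq_ofReal_abs]
  refine (enorm_integral_le_lintegral_enorm _).trans (lintegral_mono fun p => ?_)
  rw [← edist_eq_enorm_sub]
  exact hf p.1 p.2

end Wasserstein

/-! ### Lipschitz value function of a regular model -/

section WassersteinRegular

variable {X : Type*} {U : Type*} [MetricSpace X] [MeasurableSpace X] [TopologicalSpace U]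
  [MeasurableSpace U] {T : Kernel (X × U) X}
  {c : X → U → ℝ} {β B : ℝ} {Lc LT : ℝ≥0}

theorem WassersteinRegular.abs_cost_sub_le (h : WassersteinRegular T c β B Lc LT) (a : U)
    (x y : X) : |c x a - c y a| ≤ Lc * dist x y :=
  (h.cost_lipschitz a).dist_le_mul x y

theorem WassersteinRegular.abs_cost_le (h : WassersteinRegular T c β B Lc LT) (x : X) (a : U) :
    |c x a| ≤ |B| := by
  rw [abs_of_nonneg (h.cost_nonneg x a)]
  exact (h.cost_le x a).trans (le_abs_self B)

/-- The Lipschitz constant of the value function of a Wasserstein regular model. -/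
def valueLipschitz (β : ℝ) (Lc LT : ℝ≥0) : ℝ≥0 := (Lc / (1 - β * LT)).toNNReal

theorem WassersteinRegular.coe_valueLipschitz (h : WassersteinRegular T c β B Lc LT) :
    (valueLipschitz β Lc LT : ℝ) = Lc / (1 - β * LT) := by
  have := h.contraction
  exact Real.coe_toNNReal _ (div_nonneg Lc.2 (by linarith))

variable [OpensMeasurableSpace X] [IsMarkovKernel T]

theorem WassersteinRegular.abs_integral_sub_le (h : WassersteinRegular T c β B Lc LT) (f : X →ᵇ ℝ)
    {L : ℝ≥0} (hf : LipschitzWith L f) (a : U) (x y : X) :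
    |∫ z, f z ∂(T (x, a)) - ∫ z, f z ∂(T (y, a))| ≤ L * LT * dist x y := by
  have h1 := (ofReal_abs_integral_sub_le_wasserstein1 f hf (T (x, a)) (T (y, a))).trans
    (mul_le_mul_right (h.kernel_lipschitz a x y) _)
  rw [← mul_assoc, edist_dist, ← ENNReal.ofReal_coe_nnreal, ← ENNReal.ofReal_coe_nnreal,
    ← ENNReal.ofReal_mul (by positivity), ← ENNReal.ofReal_mul (by positivity)] at h1
  exact (ENNReal.ofReal_le_ofReal_iff (by positivity)).1 h1

/-- The Bellman equation of a Wasserstein regular model has a bounded Lipschitz solution. -/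
theorem WassersteinRegular.exists_value [Fintype U] [Nonempty U]
    (h : WassersteinRegular T c β B Lc LT) (hβ₀ : 0 ≤ β) (hβ₁ : β < 1) :
    ∃ V : X →ᵇ ℝ, LipschitzWith (valueLipschitz β Lc LT) V ∧ ∀ x, V x =
      Finset.univ.inf' Finset.univ_nonempty fun a => stateActionValue β c T V x a := by
  have hc (a : U) : Continuous fun x => c x a :=
    h.cost_continuous.comp (Continuous.prodMk_left a)
  have hT (f : X →ᵇ ℝ) (a : U) : Continuous fun x => ∫ y, f y ∂(T (x, a)) :=
    (h.kernel_continuous f).comp (Continuous.prodMk_left a)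
  refine exists_bellman_solution (T := T) hβ₀ hβ₁ hc h.abs_cost_le hT
    {V | LipschitzWith (valueLipschitz β Lc LT) V} ?_ ?_ ?_
  · exact (isClosed_setOfPred_lipschitzWith (valueLipschitz β Lc LT)).preimage
      (BoundedContinuousFunction.continuous_coe (α := X) (β := ℝ))
  · exact LipschitzWith.const' 0
  · intro V hV
    refine LipschitzWith.of_dist_le_mul fun x y => ?_
    rw [Real.dist_eq, bellmanOperator_apply, bellmanOperator_apply]
    refine abs_inf'_sub_inf'_le _ _ fun a _ => ?_
    have h1 := abs_le.1 (h.abs_cost_sub_le a x y)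
    have h2 := abs_le.1 (h.abs_integral_sub_le V hV a x y)
    -- The constant solves `L = Lc + β * L * LT`, which is exactly what makes the set of
    -- `L`-Lipschitz functions invariant.
    have h3 : (valueLipschitz β Lc LT : ℝ) * dist x y =
        Lc * dist x y + β * (valueLipschitz β Lc LT * LT * dist x y) := by
      have := h.contraction
      rw [h.coe_valueLipschitz]
      field_simp [show 1 - β * (LT : ℝ) ≠ 0 by linarith]
      ring
    rw [h3, abs_le]
    unfold stateActionValue
    constructor <;> nlinarith

end WassersteinRegular

/-! ### Measurable selection of actions -/

section Selection

/-- Enumerate `U` and take the first index that satisfies `p`. -/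
theorem exists_measurable_selection {X U : Type*} [MeasurableSpace X] [MeasurableSpace U]
    [Countable U] [Nonempty U] (p : X → U → Prop) (hp : ∀ a, MeasurableSet {x | p x a})
    (h : ∀ x, ∃ a, p x a) : ∃ g : X → U, Measurable g ∧ ∀ x, p x (g x) := by
  classical
  obtain ⟨e, he⟩ := exists_surjective_nat U
  have h' (x : X) : ∃ n, p x (e n) := by
    obtain ⟨a, ha⟩ := h x
    obtain ⟨n, rfl⟩ := he a
    exact ⟨n, ha⟩
  exact ⟨fun x => e (Nat.find (h' x)), (measurable_of_countable e).comp
    (measurable_find h' fun n => hp (e n)), fun x => Nat.find_spec (h' x)⟩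

end Selection

/-! ### The Bellman solution as optimal cost -/

section Optimality

variable {X : Type*} {U : Type*} [MeasurableSpace X] [MeasurableSpace U]
  {β : ℝ} {c : X → U → ℝ} {T : Kernel (X × U) X} {V : X → ℝ} {K L : ℝ}

theorem optimalCost_nonneg [IsMarkovKernel T] (hβ₀ : 0 ≤ β) (hc : ∀ x a, 0 ≤ c x a) (x : X) :
    0 ≤ optimalCost β c T x :=
  Real.iInf_nonneg fun _ => integral_nonneg fun _ => tsum_nonneg fun _ =>
    mul_nonneg (by positivity) (hc _ _)

theorem abs_optimalCost_le [IsMarkovKernel T] (hβ₀ : 0 ≤ β) (hβ₁ : β < 1)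
    (hc : Measurable fun p : X × U => c p.1 p.2) (hcK : ∀ x a, |c x a| ≤ K) (γ : Policy X U)
    (x : X) : |optimalCost β c T x| ≤ K / (1 - β) := by
  have : Nonempty (Policy X U) := ⟨γ⟩
  have h (γ : Policy X U) := abs_le.1 (abs_discountedCost_le (T := T) hβ₀ hβ₁ hc hcK γ x)
  refine abs_le.2 ⟨le_ciInf fun γ => (h γ).1, (ciInf_le ⟨-(K / (1 - β)), ?_⟩ γ).trans (h γ).2⟩
  rintro _ ⟨γ, rfl⟩
  exact (h γ).1

variable [Fintype U] [Nonempty U]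

theorem le_stateActionValue_of_bellman
    (hB : ∀ x, V x = Finset.univ.inf' Finset.univ_nonempty fun a => stateActionValue β c T V x a)
    (x : X) (a : U) : V x ≤ stateActionValue β c T V x a :=
  (hB x).trans_le (Finset.inf'_le _ (Finset.mem_univ a))

/-- A bounded solution of the Bellman equation is the optimal cost, which is attained by a
stationary policy. -/
theorem optimalCost_eq_of_bellman [IsMarkovKernel T] [MeasurableSingletonClass U]
    (hβ₀ : 0 ≤ β) (hβ₁ : β < 1)
    (hc : Measurable fun p : X × U => c p.1 p.2) (hcK : ∀ x a, |c x a| ≤ K)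
    (hV : Measurable V) (hVL : ∀ x, |V x| ≤ L)
    (hB : ∀ x, V x = Finset.univ.inf' Finset.univ_nonempty fun a => stateActionValue β c T V x a)
    (x : X) : optimalCost β c T x = V x := by
  obtain ⟨g, hg, hgV⟩ := exists_measurable_selection
    (fun x a => stateActionValue β c T V x a = V x)
    (fun a => measurableSet_eq_fun
      ((measurable_stateActionValue hc hV).comp measurable_prodMk_right) hV)
    fun x => by
      obtain ⟨a, -, ha⟩ := Finset.univ.exists_mem_eq_inf' Finset.univ_nonempty
        fun a => stateActionValue β c T V x a
      exact ⟨a, by rw [← ha, ← hB]⟩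
  exact optimalCost_eq hβ₀ hβ₁ hc hcK hV hVL (le_stateActionValue_of_bellman hB) g hg hgV x

end Optimality

/-! ### From an aggregated model to the original one -/

section Transfer

/-- Apply the self-improving bound with `e` the supremum of `|f|`; the crude bound `K` serves to
make this supremum finite. -/
theorem abs_le_div_of_contraction {X : Type*} {f : X → ℝ} {β η K : ℝ} (hβ₁ : β < 1)
    (hK : ∀ x, |f x| ≤ K) (h : ∀ e, (∀ x, |f x| ≤ e) → ∀ x, |f x| ≤ η + β * e) (x : X) :
    |f x| ≤ η / (1 - β) := by
  have : Nonempty X := ⟨x⟩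
  have hb : BddAbove (Set.range fun x => |f x|) := ⟨K, by rintro _ ⟨x, rfl⟩; exact hK x⟩
  have h1 := ciSup_le (h _ fun x => le_ciSup hb x)
  refine (le_ciSup hb x).trans ?_
  rw [le_div_iff₀ (by linarith)]
  linarith

variable {X S U : Type*} [MeasurableSpace X] [MeasurableSpace S] [MeasurableSpace U]
  [Fintype U] [Nonempty U] [MeasurableSingletonClass U]
  {β : ℝ} {c : X → U → ℝ} {T : Kernel (X × U) X} [IsMarkovKernel T] {V : X → ℝ} {K L : ℝ}
  {c' : S → U → ℝ} {T' : Kernel (S × U) S} {W : S → ℝ} {η : ℝ}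

/-- If the state-action values of an aggregated model approximate those of the original model, then
a greedy policy of the aggregated model is nearly optimal in the original model. -/
theorem robustnessError_le_of_aggregation (hβ₀ : 0 ≤ β) (hβ₁ : β < 1)
    (hc : Measurable fun p : X × U => c p.1 p.2) (hcK : ∀ x a, |c x a| ≤ K)
    (hV : Measurable V) (hVL : ∀ x, |V x| ≤ L) (hWL : ∀ i, |W i| ≤ L)
    (hVB : ∀ x, V x = Finset.univ.inf' Finset.univ_nonempty fun a => stateActionValue β c T V x a)
    (hWB : ∀ i, W i =
      Finset.univ.inf' Finset.univ_nonempty fun a => stateActionValue β c' T' W i a)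
    (q : X → S)
    (hη : ∀ e, (∀ y, |W (q y) - V y| ≤ e) → ∀ x a,
      |stateActionValue β c' T' W (q x) a - stateActionValue β c T V x a| ≤ η + β * e)
    (g : S → U) (hg : Measurable fun x => g (q x))
    (hgW : ∀ i, stateActionValue β c' T' W i (g i) = W i) :
    robustnessError β c T (Policy.stationary (fun x => g (q x)) hg) ≤
      ENNReal.ofReal (2 * η / (1 - β) ^ 2) := by
  have h1β : 0 < 1 - β := by linarith
  have hdiff : ∀ x, |W (q x) - V x| ≤ η / (1 - β) := by
    refine abs_le_div_of_contraction (K := 2 * L) hβ₁ (fun x => ?_) fun e he x => ?_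
    · have h1 := abs_le.1 (hWL (q x))
      have h2 := abs_le.1 (hVL x)
      rw [abs_le]
      constructor <;> linarith
    · rw [hWB, hVB]
      exact abs_inf'_sub_inf'_le _ _ fun a _ => hη e he x a
  -- Two errors add: `η + β * (η / (1 - β)) = η / (1 - β)` between the state-action values, and `η /
  -- (1 - β)` between `W (q x)` and `V x`.
  have hle (x : X) : stateActionValue β c T V x (g (q x)) ≤ V x + 2 * η / (1 - β) := by
    have h1 := abs_le.1 (hη _ hdiff x (g (q x)))
    have h2 := abs_le.1 (hdiff x)
    rw [hgW] at h1
    have h3 : 2 * η / (1 - β) = η + β * (η / (1 - β)) + η / (1 - β) := by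
      field_simp
      ring
    rw [h3]
    linarith
  refine iSup_le fun x => ENNReal.ofReal_le_ofReal ?_
  rw [optimalCost_eq_of_bellman hβ₀ hβ₁ hc hcK hV hVL hVB]
  have h1 := le_discountedCost hβ₀ hβ₁ hc hcK hV hVL (le_stateActionValue_of_bellman hVB)
    (Policy.stationary (fun x => g (q x)) hg) x
  have h2 := discountedCost_stationary_le hβ₀ hβ₁ hc hcK hV hVL _ hg hle x
  rw [abs_of_nonneg (by linarith)]
  calc _ ≤ 2 * η / (1 - β) / (1 - β) := by linarith
    _ = _ := by rw [div_div, sq]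

end Transfer

/-! ### Finite averages -/

section Averages

variable {ι : Type*} {s : Finset ι} {f g : ι → ℝ} {e b : ℝ}

theorem abs_sum_div_card_sub_le (hs : s.Nonempty) (h : ∀ i ∈ s, |f i - b| ≤ e) :
    |(∑ i ∈ s, f i) / s.card - b| ≤ e := by
  have hc : (0 : ℝ) < s.card := by exact_mod_cast hs.card_pos
  have : (∑ i ∈ s, f i) / s.card - b = (∑ i ∈ s, (f i - b)) / s.card := by
    rw [Finset.sum_sub_distrib, Finset.sum_const, nsmul_eq_mul]
    field_simp
  rw [this, abs_div, abs_of_pos hc, div_le_iff₀ hc]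
  refine (Finset.abs_sum_le_sum_abs _ _).trans ((Finset.sum_le_card_nsmul _ _ _ h).trans_eq ?_)
  rw [nsmul_eq_mul, mul_comm]

theorem abs_sum_div_card_sub_sum_div_card_le (hs : s.Nonempty) (h : ∀ i ∈ s, |f i - g i| ≤ e) :
    |(∑ i ∈ s, f i) / s.card - (∑ i ∈ s, g i) / s.card| ≤ e := by
  have := abs_sum_div_card_sub_le (f := fun i => f i - g i) (b := 0) hs (by simpa using h)
  rwa [sub_zero, Finset.sum_sub_distrib, sub_div] at this

end Averages

/-! ### The learned model -/

section Learned

variable {X : Type*} {U : Type*} {M : ℕ}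

theorem mem_visits {q : X → Fin M} {N : ℕ} {z : ℕ → X × U} {i : Fin M} {a : U} {n : ℕ} :
    n ∈ visits q N z i a ↔ n < N ∧ q (z n).1 = i ∧ (z n).2 = a := by
  simp [visits]

/-- Grouping the visits by the bin of the successor turns the empirical frequencies into an average
over visits. -/
theorem integral_learnedKernel [Finite U] [MeasurableSpace U] [MeasurableSingletonClass U]
    (q : X → Fin M) (N : ℕ) (z : ℕ → X × U) (i : Fin M) (a : U)
    (h : (visits q N z i a).Nonempty) (W : Fin M → ℝ) :
    ∫ j, W j ∂(learnedKernel q N z (i, a)) =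
      (∑ n ∈ visits q N z i a, W (q (z (n + 1)).1)) / (visits q N z i a).card := by
  change ∫ j, W j ∂(∑ j, ENNReal.ofReal (learnedProb q N z i a j) • Measure.dirac j) = _
  rw [integral_finsetSum_measure fun j _ => (integrable_dirac (by simp)).smul_measure (by simp)]
  simp only [integral_smul_measure, integral_dirac,
    ENNReal.toReal_ofReal (learnedProb_nonneg q N z i a _), smul_eq_mul]
  simp only [learnedProb, h.ne_empty, if_false]
  rw [← Finset.sum_fiberwise (s := visits q N z i a) (g := fun n => q (z (n + 1)).1),
    Finset.sum_div]
  refine Finset.sum_congr rfl fun j _ => ?_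
  rw [Finset.sum_congr rfl (g := fun _ => W j) fun n hn => by rw [(Finset.mem_filter.1 hn).2],
    Finset.sum_const, nsmul_eq_mul]
  ring

theorem abs_learnedCost_sub_le {c : X → U → ℝ} {q : X → Fin M} {e : ℝ}
    (hc : ∀ a x y, q x = q y → |c x a - c y a| ≤ e) (N : ℕ) (z : ℕ → X × U) (x : X) (a : U)
    (h : (visits q N z (q x) a).Nonempty) : |learnedCost c q N z (q x) a - c x a| ≤ e := by
  refine abs_sum_div_card_sub_le h fun n hn => ?_
  obtain ⟨h1, h2⟩ := (mem_visits.1 hn).2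
  rw [h2]
  exact hc a _ _ h1

theorem abs_learnedCost_le {c : X → U → ℝ} {K : ℝ} (hK : 0 ≤ K) (hc : ∀ x a, |c x a| ≤ K)
    (q : X → Fin M) (N : ℕ) (z : ℕ → X × U) (i : Fin M) (a : U) :
    |learnedCost c q N z i a| ≤ K := by
  rcases (visits q N z i a).eq_empty_or_nonempty with h | h
  · simpa [learnedCost, h] using hK
  · simpa [learnedCost] using abs_sum_div_card_sub_le (b := 0) h fun n _ => by
      simpa using hc (z n).1 (z n).2

/-- A greedy policy for the learned model is nearly optimal for the original model when the
empirical means of the optimal cost to go are close to their expectations. -/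
theorem robustnessError_le_of_empirical [MeasurableSpace X] [Fintype U] [Nonempty U]
    [MeasurableSpace U] [MeasurableSingletonClass U] {β : ℝ} {c : X → U → ℝ}
    {T : Kernel (X × U) X} [IsMarkovKernel T] {V : X → ℝ} {K L e τ : ℝ}
    (hβ₀ : 0 ≤ β) (hβ₁ : β < 1) (hK : 0 ≤ K)
    (hc : Measurable fun p : X × U => c p.1 p.2) (hcK : ∀ x a, |c x a| ≤ K)
    (hV : Measurable V) (hVL : ∀ x, |V x| ≤ L)
    (hVB : ∀ x, V x = Finset.univ.inf' Finset.univ_nonempty fun a => stateActionValue β c T V x a)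
    {q : X → Fin M} (hce : ∀ a x y, q x = q y → |c x a - c y a| ≤ e) (N : ℕ) (z : ℕ → X × U)
    (hvis : ∀ i a, (visits q N z i a).Nonempty)
    (hτ : ∀ x a, |(∑ n ∈ visits q N z (q x) a, V (z (n + 1)).1) / (visits q N z (q x) a).card -
      ∫ y, V y ∂(T (x, a))| ≤ τ)
    (g : Fin M → U) (hg : Measurable fun x => g (q x))
    (hopt : IsDiscountedOptimal β (learnedCost c q N z) (learnedKernel q N z) g) :
    robustnessError β c T (Policy.stationary (fun x => g (q x)) hg) ≤
      ENNReal.ofReal (2 * (e + β * τ) / (1 - β) ^ 2) := by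
  have hcl := abs_learnedCost_le hK hcK q N z
  obtain ⟨W, -, hWB⟩ := exists_bellman_solution (T := learnedKernel q N z) hβ₀ hβ₁
    (fun a => continuous_of_discreteTopology) hcl (fun f a => continuous_of_discreteTopology)
    Set.univ isClosed_univ (Set.mem_univ _) fun _ _ => Set.mem_univ _
  have hcm : Measurable fun p : Fin M × U => learnedCost c q N z p.1 p.2 :=
    measurable_of_countable _
  have hWm : Measurable W := measurable_of_countable _
  obtain ⟨hgm, hgo⟩ := hopt
  have hgW (i : Fin M) : stateActionValue β (learnedCost c q N z) (learnedKernel q N z) W i (g i)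
      = W i :=
    stateActionValue_eq_of_discountedCost_eq hβ₀ hβ₁ hcm hcl hWm W.norm_coe_le_norm
      (le_stateActionValue_of_bellman hWB) g hgm i
      ((hgo i).trans (optimalCost_eq_of_bellman hβ₀ hβ₁ hcm hcl hWm W.norm_coe_le_norm hWB i))
  refine robustnessError_le_of_aggregation (L := max L ‖W‖) hβ₀ hβ₁ hc hcK hV
    (fun x => (hVL x).trans (le_max_left _ _))
    (fun i => (W.norm_coe_le_norm i).trans (le_max_right _ _)) hVB hWB q (fun ε hε x a => ?_)
    g hg hgW
  have h1 := abs_le.1 (abs_learnedCost_sub_le hce N z x a (hvis _ _))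
  have h2 := abs_le.1 (hτ x a)
  -- Replacing `W ∘ q` by `V` at the observed successors costs `ε`, so only averages of the
  -- non-random `V` have to concentrate.
  have h3 := abs_le.1 (abs_sum_div_card_sub_sum_div_card_le (hvis (q x) a)
    fun n _ => hε (z (n + 1)).1)
  unfold stateActionValue
  rw [integral_learnedKernel q N z _ _ (hvis _ _), abs_le]
  constructor <;> nlinarith

end Learned

/-! ### Empirical means over cells -/

section Empirical

variable {X : Type*} {U : Type*} {M : ℕ}

/-- The empirical mean of a function of the first `N` transitions. -/
def empiricalMean (f : (X × U) × X → ℝ) (N : ℕ) (z : ℕ → X × U) : ℝ :=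
  (N : ℝ)⁻¹ * ∑ t ∈ Finset.range N, f (z t, (z (t + 1)).1)

open Classical in
/-- The function of a transition `((x, a'), y)` which equals `h y` if `x` lies in the `i`-th bin and
`a' = a`, and which vanishes otherwise. -/
def cellFunction (q : X → Fin M) (i : Fin M) (a : U) (h : X → ℝ) (p : (X × U) × X) : ℝ :=
  if q p.1.1 = i ∧ p.1.2 = a then h p.2 else 0

theorem empiricalMean_cellFunction (q : X → Fin M) (N : ℕ) (z : ℕ → X × U) (i : Fin M) (a : U)
    (h : X → ℝ) : empiricalMean (cellFunction q i a h) N z =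
      (N : ℝ)⁻¹ * ∑ n ∈ visits q N z i a, h (z (n + 1)).1 := by
  unfold empiricalMean cellFunction visits
  rw [Finset.sum_filter]

theorem cellFunction_mem_Icc {q : X → Fin M} {i : Fin M} {a : U} {h : X → ℝ}
    (hh : ∀ x, h x ∈ Set.Icc (0 : ℝ) 1) (p : (X × U) × X) :
    cellFunction q i a h p ∈ Set.Icc (0 : ℝ) 1 := by
  unfold cellFunction
  split_ifs
  · exact hh _
  · simp

variable [MeasurableSpace X] [MeasurableSpace U]

theorem measurable_empiricalMean {f : (X × U) × X → ℝ} (hf : Measurable f) (N : ℕ) :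
    Measurable (empiricalMean f N) := by
  unfold empiricalMean
  refine (Finset.measurable_sum _ fun t _ => hf.comp ?_).const_mul _
  exact (measurable_pi_apply t).prodMk (measurable_fst.comp (measurable_pi_apply (t + 1)))

variable {T : Kernel (X × U) X} {γ : Measure U} {π : Measure X}

theorem minMass_le [Finite U] (q : X → Fin M) (i : Fin M) (a : U) :
    minMass q γ π ≤ γ.real {a} * π.real (q ⁻¹' {i}) :=
  ciInf_le (Set.finite_range fun p : Fin M × U => γ.real {p.2} * π.real (q ⁻¹' {p.1})).bddBelow
    (i, a)

theorem minMass_pos [Finite U] [Nonempty U] [Nonempty X] [IsFiniteMeasure γ]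
    [IsFiniteMeasure π] (q : X → Fin M) (hγ : ∀ a, 0 < γ {a})
    (hπ : ∀ i, 0 < π (q ⁻¹' {i})) : 0 < minMass q γ π := by
  have : Nonempty (Fin M) := Nonempty.map q inferInstance
  obtain ⟨p, hp⟩ := exists_eq_ciInf_of_finite
    (f := fun p : Fin M × U => γ.real {p.2} * π.real (q ⁻¹' {p.1}))
  rw [minMass, ← hp]
  exact mul_pos (ENNReal.toReal_pos (hγ _).ne' (measure_ne_top _ _))
    (ENNReal.toReal_pos (hπ _).ne' (measure_ne_top _ _))

variable [MeasurableSingletonClass U]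

theorem measurable_cellFunction {q : X → Fin M} (hq : Measurable q) (i : Fin M) (a : U) {h : X → ℝ}
    (hh : Measurable h) : Measurable (cellFunction q i a h) := by
  classical
  refine Measurable.ite (MeasurableSet.inter ?_ ?_) (hh.comp measurable_snd) measurable_const
  · exact (hq.comp (measurable_fst.comp measurable_fst)) (measurableSet_singleton i)
  · exact (measurable_snd.comp measurable_fst) (measurableSet_singleton a)

variable [IsMarkovKernel T] [IsProbabilityMeasure γ]
  [IsProbabilityMeasure π]

instance : IsProbabilityMeasure (stationaryLaw T γ π) := by
  unfold stationaryLaw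
  infer_instance

theorem integral_cellFunction {q : X → Fin M} (hq : Measurable q) (i : Fin M) (a : U) {h : X → ℝ}
    {K : ℝ} (hh : Measurable h) (hhK : ∀ x, |h x| ≤ K) :
    ∫ p, cellFunction q i a h p ∂(stationaryLaw T γ π) =
      ∫ p in (q ⁻¹' {i}) ×ˢ {a}, ∫ y, h y ∂(T p) ∂(π.prod γ) := by
  have hK (p : (X × U) × X) : |cellFunction q i a h p| ≤ K := by
    unfold cellFunction
    split_ifs
    · exact hhK _
    · simpa using (abs_nonneg _).trans (hhK p.2)
  have hS : MeasurableSet ((q ⁻¹' {i}) ×ˢ ({a} : Set U)) :=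
    (hq (measurableSet_singleton i)).prod (measurableSet_singleton a)
  unfold stationaryLaw
  rw [Measure.integral_compProd (integrable_of_abs_le _ (measurable_cellFunction hq i a hh) hK),
    ← integral_indicator hS]
  refine integral_congr_ae (.of_forall fun p => ?_)
  by_cases hp : q p.1 = i ∧ p.2 = a
  · have hp' : p ∈ (q ⁻¹' {i}) ×ˢ ({a} : Set U) := hp
    simp [cellFunction, hp, hp']
  · have hp' : p ∉ (q ⁻¹' {i}) ×ˢ ({a} : Set U) := hp
    simp [cellFunction, hp, hp']

theorem integral_cellFunction_one {q : X → Fin M} (hq : Measurable q) (i : Fin M) (a : U) :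
    ∫ p, cellFunction q i a (fun _ => 1) p ∂(stationaryLaw T γ π) =
      γ.real {a} * π.real (q ⁻¹' {i}) := by
  rw [integral_cellFunction hq i a (K := 1) measurable_const (by simp)]
  simp [measureReal_prod_prod, mul_comm]

/-- On the cell the conditional mean of `h` is within `τ` of `v`; integrating multiplies both by the
cell mass. -/
theorem abs_integral_cellFunction_sub_le {q : X → Fin M} (hq : Measurable q) (i : Fin M) (a : U)
    {h : X → ℝ} {K τ v : ℝ} (hh : Measurable h) (hhK : ∀ x, |h x| ≤ K)
    (hv : ∀ x, q x = i → |∫ y, h y ∂(T (x, a)) - v| ≤ τ) :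
    |∫ p, cellFunction q i a h p ∂(stationaryLaw T γ π) - γ.real {a} * π.real (q ⁻¹' {i}) * v| ≤
      γ.real {a} * π.real (q ⁻¹' {i}) * τ := by
  set S := (q ⁻¹' {i}) ×ˢ ({a} : Set U) with hS
  have hb : γ.real {a} * π.real (q ⁻¹' {i}) = (π.prod γ).real S := by
    rw [hS, measureReal_prod_prod, mul_comm]
  have hi : IntegrableOn (fun p => ∫ y, h y ∂(T p)) S (π.prod γ) :=
    (integrable_of_abs_le _ (hh.stronglyMeasurable.integral_kernel (κ := T)).measurable
      fun p => abs_integral_le_of_abs_le (T p) hhK).integrableOn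
  have h1 : ∫ p, cellFunction q i a h p ∂(stationaryLaw T γ π) - (π.prod γ).real S * v =
      ∫ p in S, (∫ y, h y ∂(T p) - v) ∂(π.prod γ) := by
    rw [integral_cellFunction hq i a hh hhK, ← hS, integral_sub hi (integrable_const v),
      setIntegral_const, smul_eq_mul]
  rw [hb, h1, mul_comm, ← Real.norm_eq_abs]
  refine norm_setIntegral_le_of_norm_le_const (measure_lt_top _ _) ?_
  rintro ⟨x, a'⟩ ⟨hx, rfl : a' = a⟩
  exact hv x hx

variable (T γ π) in
/-- The deviation of the empirical mean of `f` from its stationary mean. -/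
def deviation (f : (X × U) × X → ℝ) (N : ℕ) (z : ℕ → X × U) : ℝ :=
  |empiricalMean f N z - ∫ p, f p ∂(stationaryLaw T γ π)|

omit [MeasurableSingletonClass U] [IsMarkovKernel T] [IsProbabilityMeasure γ]
  [IsProbabilityMeasure π] in
theorem measurable_deviation {f : (X × U) × X → ℝ} (hf : Measurable f) (N : ℕ) :
    Measurable (deviation T γ π f N) :=
  ((measurable_empiricalMean hf N).sub_const _).abs

/-- An unvisited cell has empirical frequency `0`, but stationary mass at least the minimum. -/
theorem minMass_le_deviation_of_visits_eq_empty [Finite U] {q : X → Fin M} (hq : Measurable q)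
    {N : ℕ} {z : ℕ → X × U} {i : Fin M} {a : U} (h : visits q N z i a = ∅) :
    minMass q γ π ≤ deviation T γ π (cellFunction q i a fun _ => 1) N z := by
  unfold deviation
  rw [empiricalMean_cellFunction, integral_cellFunction_one hq, h]
  simpa using (minMass_le q i a).trans (le_abs_self _)

/-- With `r = x / y ∈ [0, 1]`, split `b * (K * r - v) = K * r * (b - y) + K * (x - A) + (K * A - b *
v)`. Dividing by the stationary mass `b`, and not by the empirical `y`, requires only `y > 0`. -/
theorem abs_ratio_sub_le {K x y A b v τ κ d : ℝ} (hy : 0 < y) (hK : 0 ≤ K) (hx : 0 ≤ x)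
    (hxy : x ≤ y) (hκ : 0 < κ) (hb : κ ≤ b) (hA : |x - A| ≤ d) (hB : |y - b| ≤ d)
    (hv : |K * A - b * v| ≤ b * τ) : |K * x / y - v| ≤ 2 * K / κ * d + τ := by
  have hb0 : 0 < b := hκ.trans_le hb
  have hd : 0 ≤ d := (abs_nonneg _).trans hA
  set r := x / y with hr
  have hr0 : 0 ≤ r := by positivity
  have hr1 : r ≤ 1 := (div_le_one hy).2 hxy
  have hxr : x = r * y := by rw [hr]; field_simp
  have h1 : b * (K * r - v) = K * (r * (b - y)) + K * (x - A) + (K * A - b * v) := by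
    rw [hxr]; ring
  have h2 : |r * (b - y)| ≤ d := by
    rw [abs_mul, abs_of_nonneg hr0, abs_sub_comm]
    nlinarith [abs_nonneg (y - b)]
  have h3 : |b * (K * r - v)| ≤ 2 * K * d + b * τ := by
    rw [h1]
    refine (abs_add_three _ _ _).trans ?_
    rw [abs_mul K, abs_mul K, abs_of_nonneg hK]
    nlinarith
  rw [abs_mul, abs_of_pos hb0] at h3
  have h4 : |K * r - v| ≤ 2 * K * d / b + τ := by
    rw [← mul_le_mul_iff_of_pos_left hb0]
    refine h3.trans_eq ?_
    field_simp
  rw [mul_div_assoc, ← hr]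
  refine h4.trans (add_le_add_left ?_ _)
  rw [div_mul_eq_mul_div]
  exact div_le_div_of_nonneg_left (by positivity) hκ hb

/-- The average over visits is `K` times a ratio of two empirical means, in which `N` cancels; `V /
K` takes values in `[0, 1]`, as concentration requires. -/
theorem abs_average_sub_le [Finite U] {q : X → Fin M} (hq : Measurable q) {V : X → ℝ}
    {K τ d : ℝ} (hV : Measurable V) (hK : 0 < K) (hV0 : ∀ x, 0 ≤ V x) (hVK : ∀ x, V x ≤ K)
    (hκ : 0 < minMass q γ π) {N : ℕ} (hN : 1 ≤ N) (z : ℕ → X × U) (x : X) (a : U)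
    (hvis : (visits q N z (q x) a).Nonempty)
    (hτ : ∀ y, q y = q x → |∫ w, V w ∂(T (y, a)) - ∫ w, V w ∂(T (x, a))| ≤ τ)
    (h₁ : deviation T γ π (cellFunction q (q x) a fun _ => 1) N z ≤ d)
    (h₂ : deviation T γ π (cellFunction q (q x) a fun y => V y / K) N z ≤ d) :
    |(∑ n ∈ visits q N z (q x) a, V (z (n + 1)).1) / (visits q N z (q x) a).card -
      ∫ y, V y ∂(T (x, a))| ≤ 2 * K / minMass q γ π * d + τ := by
  have hN' : (0 : ℝ) < N := by exact_mod_cast hN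
  have hc : (0 : ℝ) < (visits q N z (q x) a).card := by exact_mod_cast hvis.card_pos
  unfold deviation at h₁ h₂
  rw [empiricalMean_cellFunction] at h₁ h₂
  rw [integral_cellFunction_one hq, Finset.sum_const, nsmul_eq_mul, mul_one] at h₁
  rw [← Finset.sum_div] at h₂
  have hVK' (x : X) : |V x / K| ≤ 1 := by
    rw [abs_div, abs_of_pos hK, abs_of_nonneg (hV0 x)]
    exact (div_le_one hK).2 (hVK x)
  have hv : |K * ∫ p, cellFunction q (q x) a (fun y => V y / K) p ∂(stationaryLaw T γ π) -
      γ.real {a} * π.real (q ⁻¹' {q x}) * ∫ y, V y ∂(T (x, a))| ≤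
      γ.real {a} * π.real (q ⁻¹' {q x}) * τ := by
    have h := abs_integral_cellFunction_sub_le (T := T) (γ := γ) (π := π) hq (q x) a
      (v := (∫ y, V y ∂(T (x, a))) / K) (τ := τ / K) (hV.div_const K) hVK' fun y hy => by
        rw [integral_div, ← sub_div, abs_div, abs_of_pos hK]
        exact div_le_div_of_nonneg_right (hτ y hy) hK.le
    have h' := mul_le_mul_of_nonneg_left h hK.le
    rw [← abs_of_pos hK, ← abs_mul, abs_of_pos hK, mul_sub] at h'
    field_simp at h' ⊢
    exact h'
  have hsum : (∑ n ∈ visits q N z (q x) a, V (z (n + 1)).1) ≤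
      K * (visits q N z (q x) a).card := by
    refine (Finset.sum_le_card_nsmul _ _ _ fun n _ => hVK _).trans_eq ?_
    rw [nsmul_eq_mul, mul_comm]
  have hsum0 : 0 ≤ ∑ n ∈ visits q N z (q x) a, V (z (n + 1)).1 :=
    Finset.sum_nonneg fun n _ => hV0 _
  have h := abs_ratio_sub_le (y := (N : ℝ)⁻¹ * (visits q N z (q x) a).card) (by positivity) hK.le
    (by positivity) ?_ hκ (minMass_le q (q x) a) h₂ h₁ hv
  · convert h using 3
    field_simp
  · refine mul_le_mul_of_nonneg_left ?_ (by positivity)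
    rw [div_le_iff₀ hK, mul_comm]
    exact hsum

end Empirical

/-! ### Expected maximum of sub-Gaussian deviations -/

section MaximalInequality

/-- Layer cake at the levels `(k + 1) * s`, where `v * s ^ 2 = 2 * log n`. As `2 * (k + 1) ^ 2 ≥ k +
2`, each tail is at most `C₀ * n⁻¹ ^ (k + 2)`. One factor `n⁻¹` pays for the union bound, and the
others, at most `1 / 2` each, make the series sum to at most `C₀`. -/
theorem lintegral_iSup_ofReal_le {Ω ι : Type*} [MeasurableSpace Ω] [Fintype ι] {P : Measure Ω}
    [IsProbabilityMeasure P] {D : ι → Ω → ℝ} (hD : ∀ i, AEMeasurable (D i) P) {C₀ v : ℝ}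
    (hC₀ : 0 ≤ C₀) (hv : 0 < v)
    (htail : ∀ i, ∀ ε : ℝ, 0 < ε → P.real {ω | ε ≤ D i ω} ≤ C₀ * Real.exp (-(v * ε ^ 2)))
    (hι : 2 ≤ Fintype.card ι) :
    ∫⁻ ω, ⨆ i, ENNReal.ofReal (D i ω) ∂P ≤
      ENNReal.ofReal ((1 + C₀) * √(2 * Real.log (Fintype.card ι) / v)) := by
  set n := Fintype.card ι with hnι
  set s := √(2 * Real.log n / v)
  have hn : (2 : ℝ) ≤ n := by exact_mod_cast hι
  have hlog : 0 < Real.log n := Real.log_pos (by linarith)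
  have hs : 0 < s := Real.sqrt_pos.2 (by positivity)
  have hs2 : v * s ^ 2 = 2 * Real.log n := by
    rw [Real.sq_sqrt (by positivity)]
    field_simp
  have hpt (ω : Ω) : ⨆ i, ENNReal.ofReal (D i ω) ≤ ENNReal.ofReal s + ENNReal.ofReal s *
      ∑' k : ℕ, ∑ j, {ω | (k + 1) * s ≤ D j ω}.indicator (fun _ => (1 : ℝ≥0∞)) ω := by
    refine iSup_le fun i => ?_
    set m := ⌊D i ω / s⌋₊
    have h1 : D i ω ≤ s + s * m := by
      have := (Nat.lt_floor_add_one (D i ω / s)).le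
      rw [div_le_iff₀ hs] at this
      linarith
    have h2 : (m : ℝ≥0∞) ≤
        ∑' k : ℕ, ∑ j, {ω | (k + 1) * s ≤ D j ω}.indicator (fun _ => (1 : ℝ≥0∞)) ω := by
      refine le_trans ?_ (ENNReal.sum_le_tsum (Finset.range m))
      calc (m : ℝ≥0∞) = ∑ _k ∈ Finset.range m, 1 := by simp
        _ ≤ _ := Finset.sum_le_sum fun k hk => ?_
      refine le_trans ?_ (Finset.single_le_sum (fun _ _ => zero_le) (Finset.mem_univ i))
      have hk' : ((k + 1 : ℕ) : ℝ) ≤ D i ω / s := by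
        have h0 : k + 1 ≤ m := Finset.mem_range.1 hk
        exact (Nat.le_floor_iff' (Nat.succ_ne_zero k)).1 h0
      have : ω ∈ {ω | (k + 1) * s ≤ D i ω} := by
        rw [le_div_iff₀ hs] at hk'
        exact_mod_cast hk'
      rw [Set.indicator_of_mem this]
    calc ENNReal.ofReal (D i ω) ≤ ENNReal.ofReal (s + s * m) := ENNReal.ofReal_le_ofReal h1
      _ = ENNReal.ofReal s + ENNReal.ofReal s * m := by
        rw [ENNReal.ofReal_add hs.le (by positivity), ENNReal.ofReal_mul hs.le,
          ENNReal.ofReal_natCast]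
      _ ≤ _ := by gcongr
  have hset (k : ℕ) (j : ι) : NullMeasurableSet {ω | (k + 1) * s ≤ D j ω} P :=
    nullMeasurableSet_le aemeasurable_const (hD j)
  have hprob (k : ℕ) (j : ι) : P {ω | (k + 1) * s ≤ D j ω} ≤
      ENNReal.ofReal (C₀ / n * (1 / 2) ^ (k + 1)) := by
    rw [← ofReal_measureReal]
    refine ENNReal.ofReal_le_ofReal ((htail j _ (by positivity)).trans ?_)
    rw [div_eq_mul_inv, mul_assoc]
    refine mul_le_mul_of_nonneg_left ?_ hC₀
    calc Real.exp (-(v * ((k + 1) * s) ^ 2))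
        = Real.exp (-(2 * (k + 1) ^ 2 * Real.log n)) := by
          congr 1
          linear_combination (-(k + 1 : ℝ) ^ 2) * hs2
      _ ≤ Real.exp (-((k + 2 : ℕ) * Real.log n)) := by
          refine Real.exp_le_exp.2 (neg_le_neg (mul_le_mul_of_nonneg_right ?_ hlog.le))
          push_cast
          nlinarith [(Nat.cast_nonneg k : (0 : ℝ) ≤ k)]
      _ = (n : ℝ)⁻¹ ^ (k + 2) := by
          rw [Real.exp_neg, Real.exp_nat_mul, Real.exp_log (by linarith), inv_pow]
      _ = (n : ℝ)⁻¹ * (n : ℝ)⁻¹ ^ (k + 1) := by ring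
      _ ≤ _ := by
          rw [one_div]
          gcongr
  have hsum : ∑' k : ℕ, ∑ _j : ι, ENNReal.ofReal (C₀ / n * (1 / 2) ^ (k + 1)) =
      ENNReal.ofReal C₀ := by
    have h1 (k : ℕ) : ∑ _j : ι, ENNReal.ofReal (C₀ / n * (1 / 2) ^ (k + 1)) =
        ENNReal.ofReal (C₀ / 2 / 2 ^ k) := by
      rw [Finset.sum_const, nsmul_eq_mul, Finset.card_univ, ← hnι,
        ← ENNReal.ofReal_natCast, ← ENNReal.ofReal_mul (by positivity)]
      congr 1
      have : (n : ℝ) ≠ 0 := by linarith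
      simp only [one_div, inv_pow, pow_succ]
      field_simp
    simp_rw [h1]
    have h2 : HasSum (fun k : ℕ => C₀ / 2 / 2 ^ k) C₀ := hasSum_geometric_two' C₀
    rw [← ENNReal.ofReal_tsum_of_nonneg (fun k => by positivity) h2.summable, h2.tsum_eq]
  calc ∫⁻ ω, ⨆ i, ENNReal.ofReal (D i ω) ∂P
      ≤ ∫⁻ ω, (ENNReal.ofReal s + ENNReal.ofReal s *
        ∑' k : ℕ, ∑ j, {ω | (k + 1) * s ≤ D j ω}.indicator (fun _ => (1 : ℝ≥0∞)) ω) ∂P :=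
        lintegral_mono hpt
    _ = ENNReal.ofReal s + ENNReal.ofReal s *
        ∑' k : ℕ, ∑ j, P {ω | (k + 1) * s ≤ D j ω} := by
        have hm (k : ℕ) (j : ι) : AEMeasurable
            ({ω | (k + 1) * s ≤ D j ω}.indicator fun _ => (1 : ℝ≥0∞)) P :=
          aemeasurable_const.indicator₀ (hset k j)
        rw [lintegral_add_left measurable_const, lintegral_const_mul' _ _ ENNReal.ofReal_ne_top,
          lintegral_tsum fun k => Finset.aemeasurable_fun_sum _ fun j _ => hm k j]
        rw [lintegral_const, measure_univ, mul_one]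
        congr 3 with k
        rw [lintegral_finsetSum' _ fun j _ => hm k j]
        exact Finset.sum_congr rfl fun j _ => lintegral_indicator_one₀ (hset k j)
    _ ≤ ENNReal.ofReal s + ENNReal.ofReal s * ENNReal.ofReal C₀ := by
        rw [← hsum]
        gcongr
        exact hprob _ _
    _ = ENNReal.ofReal ((1 + C₀) * s) := by
        rw [← ENNReal.ofReal_mul hs.le, ← ENNReal.ofReal_add hs.le (by positivity)]
        congr 1
        ring

end MaximalInequality

/-! ### Error of the learned policy -/

section ErrorBound

theorem dist_le_quantizationError {X : Type*} [MetricSpace X] {M : ℕ} {q : X → Fin M}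
    (h : quantizationError q ≠ ∞) {x y : X} (hxy : q x = q y) :
    dist x y ≤ (quantizationError q).toReal := by
  rw [dist_edist]
  refine ENNReal.toReal_mono h ?_
  exact (Metric.edist_le_ediam_of_mem (s := q ⁻¹' {q y}) hxy rfl).trans
    (le_iSup (fun i => Metric.ediam (q ⁻¹' {i})) (q y))

/-- The functions of a transition whose empirical means determine the quality of the learned model:
the indicators of the cells and their products with the normalized cost to go. -/
def testFunction {X U : Type*} {M : ℕ} (q : X → Fin M) (V : X → ℝ) (K : ℝ)
    (k : Fin M × U × Bool) : (X × U) × X → ℝ :=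
  cellFunction q k.1 k.2.1 (cond k.2.2 (fun y => V y / K) fun _ => 1)

section TestFunction

variable {X U : Type*} {M : ℕ} {q : X → Fin M} {V : X → ℝ} {K : ℝ}

theorem measurable_testFunction [MeasurableSpace X] [MeasurableSpace U]
    [MeasurableSingletonClass U] (hq : Measurable q) (hV : Measurable V) (k : Fin M × U × Bool) :
    Measurable (testFunction q V K k) := by
  refine measurable_cellFunction hq _ _ ?_
  cases k.2.2
  · exact measurable_const
  · exact hV.div_const K

theorem testFunction_mem_Icc (hK : 0 < K) (hV0 : ∀ x, 0 ≤ V x) (hVK : ∀ x, V x ≤ K)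
    (k : Fin M × U × Bool) (p : (X × U) × X) : testFunction q V K k p ∈ Set.Icc (0 : ℝ) 1 := by
  refine cellFunction_mem_Icc (fun x => ?_) p
  cases k.2.2
  · exact ⟨zero_le_one, le_rfl⟩
  · exact ⟨div_nonneg (hV0 x) hK.le, (div_le_one hK).2 (hVK x)⟩

end TestFunction

variable {X : Type*} [MetricSpace X] [MeasurableSpace X] [OpensMeasurableSpace X]
  {U : Type*} [Fintype U] [TopologicalSpace U] [MeasurableSpace U] [MeasurableSingletonClass U]
  {T : Kernel (X × U) X} {c : X → U → ℝ} {β B : ℝ} {Lc LT : ℝ≥0}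

theorem WassersteinRegular.measurable_cost (h : WassersteinRegular T c β B Lc LT) :
    Measurable fun p : X × U => c p.1 p.2 :=
  measurable_from_prod_countable_left fun a =>
    (h.cost_continuous.comp (Continuous.prodMk_left a)).measurable

variable [IsMarkovKernel T]

/-- The crude bound, for the event that some cell is unvisited. -/
theorem WassersteinRegular.robustnessError_le (h : WassersteinRegular T c β B Lc LT) (hβ₀ : 0 < β)
    (hβ₁ : β < 1) (γ : Policy X U) :
    robustnessError β c T γ ≤ ENNReal.ofReal (2 * (|B| / (1 - β))) := by
  refine iSup_le fun x => ENNReal.ofReal_le_ofReal ?_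
  have h1 := abs_discountedCost_le (T := T) hβ₀.le hβ₁ h.measurable_cost h.abs_cost_le γ x
  have h2 := abs_optimalCost_le (T := T) hβ₀.le hβ₁ h.measurable_cost h.abs_cost_le γ x
  refine (abs_sub _ _).trans ?_
  linarith

/-- The constant in front of the quantization error. -/
def quantizationConstant (β : ℝ) (Lc LT : ℝ≥0) : ℝ :=
  2 * valueLipschitz β Lc LT / (1 - β) ^ 2 + 1

/-- The constant in front of the sampling error, for a cost to go bounded by `K`. -/
def samplingConstant (β K : ℝ) : ℝ := 4 * β * K / (1 - β) ^ 2

variable [Nonempty U]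

/-- A bound for each fixed trajectory that visits all cells; randomness enters later, through the
deviations. -/
theorem WassersteinRegular.robustnessError_learned_le (h : WassersteinRegular T c β B Lc LT)
    (hβ₀ : 0 < β) (hβ₁ : β < 1) {M : ℕ} {q : X → Fin M} (hq : Measurable q) {γ : Measure U}
    [IsProbabilityMeasure γ] {π : Measure X} [IsProbabilityMeasure π] (hκ : 0 < minMass q γ π)
    {V : X →ᵇ ℝ} (hVL : LipschitzWith (valueLipschitz β Lc LT) V)
    (hVB : ∀ x, V x = Finset.univ.inf' Finset.univ_nonempty fun a => stateActionValue β c T V x a)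
    {K : ℝ} (hK : 0 < K) (hV0 : ∀ x, 0 ≤ V x) (hVK : ∀ x, V x ≤ K) {N : ℕ} (hN : 1 ≤ N)
    (z : ℕ → X × U) (hvis : ∀ i a, (visits q N z i a).Nonempty) (g : Fin M → U)
    (hg : Measurable fun x => g (q x))
    (hopt : IsDiscountedOptimal β (learnedCost c q N z) (learnedKernel q N z) g) :
    robustnessError β c T (Policy.stationary (fun x => g (q x)) hg) ≤
      ENNReal.ofReal (quantizationConstant β Lc LT) * quantizationError q +
      ENNReal.ofReal (samplingConstant β K / minMass q γ π) *
        ⨆ k, ENNReal.ofReal (deviation T γ π (testFunction q V K k) N z) := by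
  have h1β : 0 < 1 - β := by linarith
  have hA : 0 < quantizationConstant β Lc LT := by
    unfold quantizationConstant
    positivity
  -- The summand `1` in `quantizationConstant` keeps the product infinite here even if `Lc = 0`.
  rcases eq_or_ne (quantizationError q) ∞ with hδ | hδ
  · rw [hδ, ENNReal.mul_top (by simpa using hA), top_add]
    exact le_top
  set δ := (quantizationError q).toReal
  have hδ0 : 0 ≤ δ := ENNReal.toReal_nonneg
  set D := ⨆ k, ENNReal.ofReal (deviation T γ π (testFunction q V K k) N z) with hD
  have hDtop : D ≠ ∞ := by
    have : D < ∞ := by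
      rw [hD, ← Finset.sup_univ_eq_iSup, Finset.sup_lt_iff (by simp)]
      exact fun _ _ => ENNReal.ofReal_lt_top
    exact this.ne
  set d := D.toReal
  have hδd : quantizationError q = ENNReal.ofReal δ := (ENNReal.ofReal_toReal hδ).symm
  have hDd : D = ENNReal.ofReal d := (ENNReal.ofReal_toReal hDtop).symm
  have hd0 : 0 ≤ d := ENNReal.toReal_nonneg
  have hd (k : Fin M × U × Bool) : deviation T γ π (testFunction q V K k) N z ≤ d :=
    (ENNReal.ofReal_le_iff_le_toReal hDtop).1
      (le_iSup (fun k => ENNReal.ofReal (deviation T γ π (testFunction q V K k) N z)) k)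
  have hdist {x y : X} (hxy : q x = q y) : dist x y ≤ δ := dist_le_quantizationError hδ hxy
  set L := valueLipschitz β Lc LT with hL
  have key := robustnessError_le_of_empirical hβ₀.le hβ₁ (abs_nonneg B) h.measurable_cost
    h.abs_cost_le V.continuous.measurable V.norm_coe_le_norm hVB (e := Lc * δ)
    (τ := 2 * K / minMass q γ π * d + L * LT * δ)
    (fun a x y hxy => (h.abs_cost_sub_le a x y).trans
      (mul_le_mul_of_nonneg_left (hdist hxy) Lc.2)) N z hvis
    (fun x a => abs_average_sub_le hq V.continuous.measurable hK hV0 hVK hκ hN z x a (hvis _ _)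
      (fun y hy => (h.abs_integral_sub_le V hVL a y x).trans
        (mul_le_mul_of_nonneg_left (hdist hy) (by positivity)))
      (hd (q x, a, false)) (hd (q x, a, true))) g hg hopt
  refine key.trans ?_
  -- The quantization errors of cost and kernel recombine to `L` by the equation defining it.
  have hLeq : (Lc : ℝ) + β * (L * LT) = L := by
    have := h.contraction
    rw [hL, h.coe_valueLipschitz]
    field_simp [show 1 - β * (LT : ℝ) ≠ 0 by linarith]
    ring
  have hS : 0 ≤ samplingConstant β K / minMass q γ π := by
    unfold samplingConstant
    positivity
  rw [hδd, hDd, ← ENNReal.ofReal_mul hA.le,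
    ← ENNReal.ofReal_mul hS, ← ENNReal.ofReal_add (by positivity) (by positivity)]
  refine ENNReal.ofReal_le_ofReal ?_
  have : 2 * (Lc * δ + β * (2 * K / minMass q γ π * d + L * LT * δ)) / (1 - β) ^ 2 =
      2 * (Lc + β * (L * LT)) / (1 - β) ^ 2 * δ +
        samplingConstant β K / minMass q γ π * d := by
    unfold samplingConstant
    field_simp
    ring
  rw [this, hLeq]
  unfold quantizationConstant
  change _ ≤ (2 * L / (1 - β) ^ 2 + 1) * δ + _
  linarith

/-- Absorbs the factor `2` from having two test functions per cell. -/
theorem log_two_mul_le {m : ℕ} (hm : 2 ≤ m) : Real.log (2 * m) ≤ 2 * Real.log m := by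
  have hm' : (2 : ℝ) ≤ m := by exact_mod_cast hm
  rw [Real.log_mul (by norm_num) (by positivity)]
  linarith [Real.log_le_log (by norm_num) hm']

/-- The expected error of the learned policy, with explicit constants. -/
theorem WassersteinRegular.lintegral_robustnessError_le (h : WassersteinRegular T c β B Lc LT)
    (hβ₀ : 0 < β) (hβ₁ : β < 1) {M : ℕ} {q : X → Fin M} (hq : Measurable q) {γ : Measure U}
    [IsProbabilityMeasure γ] {π : Measure X} [IsProbabilityMeasure π] (hκ : 0 < minMass q γ π)
    (hMU : 2 ≤ M * Fintype.card U)
    {Ω : Type*} [MeasurableSpace Ω] {P : Measure Ω} [IsProbabilityMeasure P]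
    {Y : Ω → ℕ → X × U} (hY : AEMeasurable Y P) {C₀ c₀ : ℝ} (hC₀ : 0 < C₀) (hc₀ : 0 < c₀)
    (hconc : Concentrates P Y T γ π C₀ c₀) {N : ℕ} (hN : 1 ≤ N) (g : Ω → Fin M → U)
    (hg : ∀ ω, Measurable fun x => g ω (q x))
    (hopt : ∀ᵐ ω ∂P, IsDiscountedOptimal β (learnedCost c q N (Y ω))
      (learnedKernel q N (Y ω)) (g ω)) :
    ∫⁻ ω, robustnessError β c T (Policy.stationary (fun x => g ω (q x)) (hg ω)) ∂P ≤
      ENNReal.ofReal (quantizationConstant β Lc LT) * quantizationError q +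
      ENNReal.ofReal (samplingConstant β ((|B| + 1) / (1 - β)) / minMass q γ π) *
        ENNReal.ofReal ((1 + C₀) * (2 / √c₀ * √(Real.log (M * Fintype.card U) / N))) +
      ENNReal.ofReal (2 * ((|B| + 1) / (1 - β)) *
        (M * Fintype.card U * (C₀ * Real.exp (-(c₀ * N * minMass q γ π ^ 2))))) := by
  classical
  have h1β : 0 < 1 - β := by linarith
  have hN' : (0 : ℝ) < N := by exact_mod_cast hN
  -- The added `1` makes `K` positive when `B = 0`, so that `V / K` is a genuine normalization.
  set K := (|B| + 1) / (1 - β) with hKdef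
  have hK : 0 < K := by positivity
  have hBK : |B| / (1 - β) ≤ K := div_le_div_of_nonneg_right (by linarith) h1β.le
  set κ := minMass q γ π
  obtain ⟨V, hVL, hVB⟩ := h.exists_value hβ₀.le hβ₁
  have hVopt (x : X) : optimalCost β c T x = V x := optimalCost_eq_of_bellman hβ₀.le hβ₁
    h.measurable_cost h.abs_cost_le V.continuous.measurable V.norm_coe_le_norm hVB x
  have hV0 (x : X) : 0 ≤ V x := hVopt x ▸ optimalCost_nonneg hβ₀.le h.cost_nonneg x
  have hVK (x : X) : V x ≤ K := by
    rw [← hVopt]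
    exact (le_abs_self _).trans ((abs_optimalCost_le hβ₀.le hβ₁ h.measurable_cost h.abs_cost_le
      (Policy.exploration γ) x).trans hBK)
  set D : Fin M × U × Bool → Ω → ℝ := fun k ω =>
    deviation T γ π (testFunction q V K k) N (Y ω) with hD
  have hDm (k : Fin M × U × Bool) : AEMeasurable (D k) P :=
    (measurable_deviation (measurable_testFunction hq V.continuous.measurable k) N).comp_aemeasurable
      hY
  have htail (k : Fin M × U × Bool) (ε : ℝ) (hε : 0 < ε) :
      P.real {ω | ε ≤ D k ω} ≤ C₀ * Real.exp (-(c₀ * N * ε ^ 2)) :=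
    hconc _ (measurable_testFunction hq V.continuous.measurable k)
      (testFunction_mem_Icc hK hV0 hVK k) ε hε N hN
  set F : Fin M × U → Set Ω := fun p => {ω | κ ≤ D (p.1, p.2, false) ω}
  have hF (p : Fin M × U) : NullMeasurableSet (F p) P :=
    nullMeasurableSet_le aemeasurable_const (hDm _)
  have hS : 0 ≤ samplingConstant β K / κ := by
    unfold samplingConstant
    positivity
  -- The last sum is at least `1` whenever a cell is unvisited. The right side is a.e. measurable,
  -- so its integral splits without measurability of the error itself.
  have hpt : ∀ᵐ ω ∂P, robustnessError β c T (Policy.stationary (fun x => g ω (q x)) (hg ω)) ≤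
      ENNReal.ofReal (quantizationConstant β Lc LT) * quantizationError q +
      ENNReal.ofReal (samplingConstant β K / κ) * (⨆ k, ENNReal.ofReal (D k ω)) +
      ENNReal.ofReal (2 * K) * ∑ p, (F p).indicator (fun _ => (1 : ℝ≥0∞)) ω := by
    filter_upwards [hopt] with ω hω
    by_cases hvis : ∀ i a, (visits q N (Y ω) i a).Nonempty
    · exact (h.robustnessError_learned_le hβ₀ hβ₁ hq hκ hVL hVB hK hV0 hVK hN (Y ω) hvis (g ω)
        (hg ω) hω).trans le_self_add
    · push Not at hvis
      obtain ⟨i, a, hia⟩ := hvis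
      have hmem : ω ∈ F (i, a) := minMass_le_deviation_of_visits_eq_empty hq hia
      refine ((h.robustnessError_le hβ₀ hβ₁ _).trans ?_).trans le_add_self
      calc ENNReal.ofReal (2 * (|B| / (1 - β))) ≤ ENNReal.ofReal (2 * K) :=
            ENNReal.ofReal_le_ofReal (by linarith)
        _ = ENNReal.ofReal (2 * K) * (F (i, a)).indicator (fun _ => (1 : ℝ≥0∞)) ω := by
            rw [Set.indicator_of_mem hmem, mul_one]
        _ ≤ _ := mul_le_mul_right (Finset.single_le_sum
            (f := fun p => (F p).indicator (fun _ => (1 : ℝ≥0∞)) ω)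
            (fun _ _ => zero_le) (Finset.mem_univ (i, a))) _
  have hsup : ∫⁻ ω, ⨆ k, ENNReal.ofReal (D k ω) ∂P ≤
      ENNReal.ofReal ((1 + C₀) * (2 / √c₀ * √(Real.log (M * Fintype.card U) / N))) := by
    have hcard : Fintype.card (Fin M × U × Bool) = 2 * (M * Fintype.card U) := by
      simp only [Fintype.card_prod, Fintype.card_fin, Fintype.card_bool]
      ring
    refine (lintegral_iSup_ofReal_le hDm hC₀.le (by positivity) htail (by omega)).trans
      (ENNReal.ofReal_le_ofReal (mul_le_mul_of_nonneg_left ?_ (by positivity)))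
    have hl := log_two_mul_le hMU
    rw [hcard]
    push_cast at hl ⊢
    -- The `4` is the `2` of the maximal inequality times the `2` from `log_two_mul_le`.
    have h2 : 2 / √c₀ = √(4 / c₀) := by
      rw [Real.sqrt_div (by norm_num), show (4 : ℝ) = 2 ^ 2 by norm_num,
        Real.sqrt_sq (by norm_num)]
    rw [h2, ← Real.sqrt_mul (by positivity)]
    refine Real.sqrt_le_sqrt ?_
    rw [div_mul_div_comm]
    exact div_le_div_of_nonneg_right (by linarith) (by positivity)
  have hsum : ∑ p, P (F p) ≤
      ENNReal.ofReal (M * Fintype.card U * (C₀ * Real.exp (-(c₀ * N * κ ^ 2)))) := by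
    calc ∑ p, P (F p) ≤ ∑ _p : Fin M × U, ENNReal.ofReal (C₀ * Real.exp (-(c₀ * N * κ ^ 2))) := by
          refine Finset.sum_le_sum fun p _ => ?_
          rw [← ofReal_measureReal]
          exact ENNReal.ofReal_le_ofReal (htail _ κ hκ)
      _ = _ := by
          rw [Finset.sum_const, nsmul_eq_mul, ← ENNReal.ofReal_natCast,
            ← ENNReal.ofReal_mul (by positivity)]
          simp
  have hDsup : AEMeasurable (fun ω => ⨆ k, ENNReal.ofReal (D k ω)) P :=
    AEMeasurable.iSup fun k => (hDm k).ennreal_ofReal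
  have hind (p : Fin M × U) : ∫⁻ ω, (F p).indicator (fun _ => (1 : ℝ≥0∞)) ω ∂P = P (F p) :=
    lintegral_indicator_one₀ (hF p)
  have hm : AEMeasurable (fun ω => ENNReal.ofReal (quantizationConstant β Lc LT) *
      quantizationError q + ENNReal.ofReal (samplingConstant β K / κ) *
        ⨆ k, ENNReal.ofReal (D k ω)) P :=
    aemeasurable_const.add (hDsup.const_mul _)
  refine (lintegral_mono_ae hpt).trans ?_
  rw [lintegral_add_left' hm,
    lintegral_add_left measurable_const, lintegral_const, measure_univ, mul_one,
    lintegral_const_mul' _ _ ENNReal.ofReal_ne_top, lintegral_const_mul' _ _ ENNReal.ofReal_ne_top,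
    lintegral_finsetSum' _ fun p _ => aemeasurable_const.indicator₀ (hF p),
    ENNReal.ofReal_mul (by positivity : 0 ≤ 2 * K)]
  simp_rw [hind]
  gcongr

end ErrorBound
end QuantizedMDP

end

/-! ### Choice of the constant -/

open QuantizedMDP in
theorem mainTheorem6 (β : ℝ) (hβ₀ : 0 < β) (hβ₁ : β < 1) (B C₀ c₀ : ℝ) (hC₀ : 0 < C₀)
    (hc₀ : 0 < c₀) (Lc LT : ℝ≥0) :
    ∃ C : ℝ, 0 < C ∧
      ∀ (X : Type u) [MetricSpace X] [CompleteSpace X] [SecondCountableTopology X]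
        [MeasurableSpace X] [BorelSpace X]
        (U : Type v) [Fintype U] [TopologicalSpace U] [DiscreteTopology U]
        [MeasurableSpace U] [BorelSpace U]
        (T : Kernel (X × U) X) [IsMarkovKernel T] (c : X → U → ℝ)
        (_ : WassersteinRegular T c β B Lc LT)
        -- the quantizer, i.e. the measurable partition of `X` into `M` bins
        (M : ℕ) (q : X → Fin M) (hq : Measurable q)
        -- the exploration policy and the stationary law of the state
        (γ : Measure U) [IsProbabilityMeasure γ] (_ : ∀ a, 0 < γ {a})
        (π : Measure X) [IsProbabilityMeasure π] (_ : ∀ i, 0 < π (q ⁻¹' {i}))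
        (_ : ErgodicExploration T γ π)
        -- the observed trajectory `Y ω n = (X_n, U_n)`, with `X_0 ∼ ν`
        (ν : Measure X) [IsProbabilityMeasure ν]
        (Ω : Type w) [MeasurableSpace Ω] (P : Measure Ω) [IsProbabilityMeasure P]
        (Y : Ω → ℕ → X × U) (_ : HasLaw Y (pathLaw T (Policy.exploration γ) ν) P)
        (_ : Concentrates P Y T γ π C₀ c₀)
        (N : ℕ) (_ : 1 ≤ N)
        -- an optimal policy for the model learned from the first `N` transitions
        (g : Ω → Fin M → U) (_ : AEMeasurable g P)
        (_ : ∀ᵐ ω ∂P, IsDiscountedOptimal β (learnedCost c q N (Y ω))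
          (learnedKernel q N (Y ω)) (g ω)),
        ∫⁻ ω, robustnessError β c T (Policy.stationary (fun x => g ω (q x))
            ((measurable_of_countable (g ω)).comp hq)) ∂P
          ≤ ENNReal.ofReal C * (quantizationError q + ENNReal.ofReal
                ((minMass q γ π)⁻¹ * √(Real.log (M * Fintype.card U) / N)))
            + ENNReal.ofReal (C * M * Fintype.card U *
                Real.exp (-(C⁻¹ * minMass q γ π ^ 2 * N))) := by
  have h1β : 0 < 1 - β := by linarith
  set K := (|B| + 1) / (1 - β) with hK
  set C₁ := quantizationConstant β Lc LT with hC₁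
  set C₂ := samplingConstant β K * ((1 + C₀) * (2 / √c₀)) with hC₂
  set C₃ := 2 * K * C₀ with hC₃
  have hK0 : 0 < K := by positivity
  have hC₁0 : 0 < C₁ := by
    rw [hC₁]
    unfold quantizationConstant
    positivity
  have hS0 : 0 < samplingConstant β K := by
    unfold samplingConstant
    positivity
  have hC₂0 : 0 < C₂ := by positivity
  have hC₃0 : 0 < C₃ := by positivity
  have hci : 0 < c₀⁻¹ := by positivity
  -- The sum dominates each prefactor, and the summand `c₀⁻¹` gives `C⁻¹ ≤ c₀` for the exponent.
  refine ⟨C₁ + C₂ + C₃ + c₀⁻¹, by positivity, ?_⟩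
  intro X _ _ _ _ _ U _ _ _ _ _ T _ c hreg M q hq γ _ hγ π _ hπ _ ν _ Ω _ P _ Y hY hconc N hN g _
    hopt
  set C := C₁ + C₂ + C₃ + c₀⁻¹ with hC
  have hC0 : 0 < C := by positivity
  obtain ⟨x₀⟩ : Nonempty X := nonempty_of_isProbabilityMeasure π
  have : Nonempty U := nonempty_of_isProbabilityMeasure γ
  rcases subsingleton_or_nontrivial U with hU | hU
  · simp [robustnessError_eq_zero_of_subsingleton]
  have : Nonempty X := ⟨x₀⟩
  have hκ : 0 < minMass q γ π := minMass_pos q hγ hπ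
  have hMU : 2 ≤ M * Fintype.card U := by
    have h1 : 0 < M := (q x₀).pos
    have h2 : 1 < Fintype.card U := Fintype.one_lt_card
    nlinarith
  refine (hreg.lintegral_robustnessError_le hβ₀ hβ₁ hq hκ hMU hY.aemeasurable hC₀ hc₀ hconc hN g _
    hopt).trans (add_le_add ?_ (ENNReal.ofReal_le_ofReal ?_))
  · rw [mul_add, ← ENNReal.ofReal_mul (by positivity), ← ENNReal.ofReal_mul hC0.le]
    refine add_le_add (mul_le_mul_left (ENNReal.ofReal_le_ofReal (by linarith)) _)
      (ENNReal.ofReal_le_ofReal ?_)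
    calc _ = C₂ * ((minMass q γ π)⁻¹ * √(Real.log (M * Fintype.card U) / N)) := by
          rw [hC₂]
          ring
      _ ≤ _ := mul_le_mul_of_nonneg_right (by linarith) (by positivity)
  · have hexp : Real.exp (-(c₀ * N * minMass q γ π ^ 2)) ≤
        Real.exp (-(C⁻¹ * minMass q γ π ^ 2 * N)) := by
      refine Real.exp_le_exp.2 (neg_le_neg ?_)
      have : C⁻¹ ≤ c₀ := inv_le_of_inv_le₀ hc₀ (by linarith)
      calc C⁻¹ * minMass q γ π ^ 2 * N ≤ c₀ * minMass q γ π ^ 2 * N := by gcongr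
        _ = _ := by ring
    calc _ = C₃ * M * Fintype.card U * Real.exp (-(c₀ * N * minMass q γ π ^ 2)) := by
          rw [hC₃]
          ring
      _ ≤ _ := by
          gcongr
          linarith
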